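/- **Setting.** Let $q\ge 2$ be an integer and let $\mathbb T$ be the $(q+1)$-regular tree, labelled as follows. A vertex of level $m\in\mathbb Z$ is a sequence $(u_k)_{k\le m}$ with values in $\{0,\dots,q-1\}$ that equals $0$ for all sufficiently negative $k$. Each vertex is joined by an edge to its first ancestor, obtained by deleting the last letter; $vt$ denotes the sequence $v$ with the letter $t$ appended. Let $\omega$ be the end of $\mathbb T$ represented by the ray $\omega(n)=$ (the zero sequence of level $-n$), $n\ge 0$, and let $\mathrm{Aff}(\mathbb T)$ be the group of graph automorphisms of $\mathbb T$ that fix $\omega$. For $g\in\mathrm{Aff}(\mathbb T)$ and a vertex $v$, let $g[v]$ be the permutation of $\{0,\dots,q-1\}$ for which $g$ maps $vt$ to $g(v)\,g[v](t)$ for every letter $t$. The discrete affine group is $$\mathrm{DA}(\mathbb T)=\{g\in \mathrm{Aff}(\mathbb T) : g[v]=\mathrm{id} \text{ for all but finitely many vertices } v\}.$$ For a symmetric probability measure $\mu$ on a finitely generated group $\Gamma$, its $L_1$-isoperimetric profile is $$\Lambda_{1,\Gamma,\mu}(v)=\inf\Big\{\tfrac12\sum_{x,y\in\Gamma}|f(x)-f(xy)|\,\mu(y)\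 :\ f\colon\Gamma\to\mathbb R,\ |\mathrm{supp} f|\le v,\ \|f\|_1=1\Big\},\qquad v\ge 1 .$$ Let $\mu^{(n)}$ be the $n$-fold convolution power of $\mu$, and $e$ the identity. For real functions $F,G$ defined for all large real numbers, write $F\lesssim G$ if there are constants $C_1,C_2>0$ with $F(t)\le C_1G(C_2t)$ for all large enough $t$, and $F\simeq G$ if $F\lesssim G$ and $G\lesssim F$; a function of an integer $n$ is extended to real $t>0$ by putting $n=\lfloor t\rfloor$. **Proposition.** Let $\mu$ be a finitely supported symmetric probability measure on $\mathrm{DA}(\mathbb T)$ which is non-degenerate, i.e. its support generates $\mathrm{DA}(\mathbb T)$ as a semigroup. Then $$\Lambda_{1,\mathrm{DA}(\mathbb T),\mu}(v)\simeq\frac1{\log\log v}\qquad\text{and}\qquad \mu^{(2n)}(e)\simeq \exp\!\Big(-\frac{n}{(\log n)^2}\Big).$$ -/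

import Mathlib

open Filter

namespace DiscreteAffine

/-! ### The labelled `(q+1)`-regular tree -/

/-- A vertex of the tree: a horocycle index `level = m` together with a sequence of letters of
`{0, …, q-1}` indexed by the integers `k ≤ m`, equal to `0` near `-∞`.
The sequence is stored as a function on `ℤ` extended by `0` to the indices `k > m`. -/
@[ext]
structure Vertex (q : ℕ) [NeZero q] where
  level : ℤ
  label : ℤ → Fin q
  label_above : ∀ k, level < k → label k = 0
  label_below : ∃ n : ℤ, ∀ k, k ≤ n → label k = 0

variable {q : ℕ} [NeZero q]

/-- The first ancestor: delete the last letter. -/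
def Vertex.parent (v : Vertex q) : Vertex q where
  level := v.level - 1
  label := Function.update v.label v.level 0
  label_above := by
    intro k hk
    by_cases h : k = v.level
    · simp [h]
    · rw [Function.update_of_ne h]
      exact v.label_above k (by omega)
  label_below := by
    obtain ⟨n, hn⟩ := v.label_below
    refine ⟨n, fun k hk => ?_⟩
    by_cases h : k = v.level
    · simp [h]
    · rw [Function.update_of_ne h]
      exact hn k hk

/-- The descendant `vt` of `v`: append the letter `t`. -/
def Vertex.child (v : Vertex q) (t : Fin q) : Vertex q where
  level := v.level + 1
  label := Function.update v.label (v.level + 1) t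
  label_above := by
    intro k hk
    rw [Function.update_of_ne (by omega)]
    exact v.label_above k (by omega)
  label_below := by
    obtain ⟨n, hn⟩ := v.label_below
    refine ⟨min n v.level, fun k hk => ?_⟩
    rw [Function.update_of_ne (by omega)]
    exact hn k (by omega)

/-- The last (rightmost) letter of the sequence labelling `v`. -/
def Vertex.last (v : Vertex q) : Fin q := v.label v.level

@[simp] lemma Vertex.parent_level (v : Vertex q) : v.parent.level = v.level - 1 := rfl

@[simp] lemma Vertex.child_level (v : Vertex q) (t : Fin q) :
    (v.child t).level = v.level + 1 := rfl

@[simp] lemma Vertex.last_child (v : Vertex q) (t : Fin q) : (v.child t).last = t := by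
  simp [Vertex.last, Vertex.child]

@[simp] lemma Vertex.parent_child (v : Vertex q) (t : Fin q) : (v.child t).parent = v := by
  ext k
  · simp
  · by_cases h : k = v.level + 1
    · subst h
      simp [Vertex.parent, Vertex.child, v.label_above (v.level + 1) (by omega)]
    · simp [Vertex.parent, Vertex.child, h]

@[simp] lemma Vertex.child_parent_last (v : Vertex q) : v.parent.child v.last = v := by
  ext k
  · simp
  · by_cases h : k = v.level
    · subst h
      simp [Vertex.parent, Vertex.child, Vertex.last]
    · simp [Vertex.parent, Vertex.child, h]

/-- The `(q+1)`-regular tree: the edges link each vertex to its first ancestor. -/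
def tree (q : ℕ) [NeZero q] : SimpleGraph (Vertex q) where
  Adj u v := u = v.parent ∨ v = u.parent
  symm := ⟨fun _ _ h => h.symm⟩
  loopless := ⟨fun v h => by
    have h' : v = v.parent := h.elim id id
    have h2 : v.level = v.level - 1 := congrArg Vertex.level h'
    omega⟩

/-- The vertex `ω(n)` on the distinguished geodesic ray from `o = ω(0)`: the sequence constant
equal to `0` on the integers `k ≤ -n`. -/
def ray (q : ℕ) [NeZero q] (n : ℕ) : Vertex q where
  level := -n
  label := fun _ => 0
  label_above := fun _ _ => rfl
  label_below := ⟨0, fun _ _ => rfl⟩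

/-! ### The affine group of the tree -/

/-- The affine group: the automorphisms of the tree that fix the end of the distinguished ray,
two geodesic rays defining the same end when their symmetric difference is finite.
The group law is composition of automorphisms. -/
def affineGroup (q : ℕ) [NeZero q] : Subgroup (tree q ≃g tree q) where
  carrier := {g | (symmDiff (g '' Set.range (ray q)) (Set.range (ray q))).Finite}
  one_mem' := by
    have h : ((1 : tree q ≃g tree q) : Vertex q → Vertex q) '' Set.range (ray q)
        = Set.range (ray q) := by
      ext x; simp
    simp only [Set.mem_ofPred_eq]
    rw [h]
    simp
  mul_mem' := by
    intro g h hg hh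
    simp only [Set.mem_ofPred_eq] at *
    have e : ((g * h : tree q ≃g tree q) : Vertex q → Vertex q) '' Set.range (ray q)
        = g '' (h '' Set.range (ray q)) := by
      rw [Set.image_image]; rfl
    rw [e]
    refine ((hh.image g).union hg).subset ?_
    rw [Set.image_symmDiff g.injective]
    exact symmDiff_triangle _ _ _
  inv_mem' := by
    intro g hg
    simp only [Set.mem_ofPred_eq] at *
    have e : Set.range (ray q)
        = ((g⁻¹ : tree q ≃g tree q) : Vertex q → Vertex q) '' (g '' Set.range (ray q)) := by
      rw [Set.image_image]
      have : ∀ x, (g⁻¹ : tree q ≃g tree q) (g x) = x := fun x => g.symm_apply_apply x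
      simp [this]
    have := hg.image (g⁻¹ : tree q ≃g tree q)
    rw [Set.image_symmDiff (g⁻¹ : tree q ≃g tree q).injective, ← e, symmDiff_comm] at this
    exact this

lemma ray_injective : Function.Injective (ray q) := by
  intro a b h
  have := congrArg Vertex.level h
  simpa [ray] using this

lemma parent_iterate_level (v : Vertex q) (n : ℕ) :
    (Vertex.parent^[n] v).level = v.level - n := by
  induction n with
  | zero => simp
  | succ n ih => rw [Function.iterate_succ_apply']; simp [ih]; ring

lemma parent_iterate_label (v : Vertex q) (n : ℕ) {k : ℤ} (hk : k ≤ v.level - n) :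
    (Vertex.parent^[n] v).label k = v.label k := by
  induction n with
  | zero => simp
  | succ n ih =>
    rw [Function.iterate_succ_apply', ← ih (by push_cast at hk; omega)]
    refine Function.update_of_ne ?_ _ _
    rw [parent_iterate_level]; push_cast at hk; omega

/-- Every vertex has all its distant ancestors on the distinguished ray. -/
lemma exists_ancestors_ray (v : Vertex q) :
    ∃ N : ℕ, ∀ n, N ≤ n → ∃ k : ℕ, (k : ℤ) = n - v.level ∧ Vertex.parent^[n] v = ray q k := by
  obtain ⟨m, hm⟩ := v.label_below
  refine ⟨(max v.level (v.level - m)).toNat, fun n hn => ⟨(n - v.level).toNat, by omega, ?_⟩⟩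
  ext k
  · rw [parent_iterate_level]; simp only [ray]; omega
  · congr 1
    by_cases hk : k ≤ v.level - n
    · rw [parent_iterate_label v n hk, hm k (by omega)]; rfl
    · rw [(Vertex.parent^[n] v).label_above k (by rw [parent_iterate_level]; omega)]; rfl

/-- An affine transformation maps the first ancestor of a vertex to the first ancestor of its
image. -/
lemma affine_parent {g : tree q ≃g tree q} (hg : g ∈ affineGroup q) (v : Vertex q) :
    g v.parent = (g v).parent := by
  have step : ∀ w : Vertex q, g w.parent = (g w).parent ∨ g w = (g w.parent).parent := by
    intro w
    have h : (tree q).Adj (g w.parent) (g w) := g.map_rel_iff.2 (Or.inl rfl)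
    exact h
  by_contra hne
  have down : ∀ n : ℕ, g (Vertex.parent^[n] v) = (g (Vertex.parent^[n+1] v)).parent := by
    intro n
    induction n with
    | zero => exact (step v).resolve_left hne
    | succ n ih =>
      rw [Function.iterate_succ_apply' _ (n + 1)]
      refine (step _).resolve_left fun h => ?_
      have h1 := g.injective (h.trans ih.symm)
      have h2 := congrArg Vertex.level h1
      rw [← Function.iterate_succ_apply' Vertex.parent] at h2
      simp only [parent_iterate_level] at h2
      push_cast at h2
      omega
  have lev : ∀ n : ℕ, (g (Vertex.parent^[n] v)).level = (g v).level + n := by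
    intro n
    induction n with
    | zero => simp
    | succ n ih =>
      have := congrArg Vertex.level (down n)
      rw [ih, Vertex.parent_level] at this
      push_cast; omega
  obtain ⟨N, hN⟩ := exists_ancestors_ray v
  have hfin : {k : ℕ | g (ray q k) ∉ Set.range (ray q)}.Finite := by
    have h1 : (symmDiff (g '' Set.range (ray q)) (Set.range (ray q))).Finite := hg
    refine (h1.preimage ((g.injective.comp ray_injective).injOn)).subset ?_
    intro k hk
    exact Or.inl ⟨⟨_, ⟨k, rfl⟩, rfl⟩, hk⟩
  obtain ⟨B, hB⟩ := hfin.bddAbove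
  set n : ℕ := N + (B + 1 + v.level.toNat) + (1 - (g v).level).toNat with hn
  obtain ⟨k, hk, hray⟩ := hN n (by omega)
  have hmem : g (ray q k) ∈ Set.range (ray q) := by
    by_contra hcon
    have : k ≤ B := hB hcon
    omega
  obtain ⟨j, hj⟩ := hmem
  have h3 := lev n
  rw [hray, ← hj] at h3
  simp only [ray] at h3
  omega

/-! ### Portraits and the discrete affine group -/

/-- The portrait of an affine transformation `g`: its value at `v` is the permutation of the
letters `{0, …, q-1}` such that `g` maps `vt` to the descendant of `g v` with
last letter `g[v](t)`. For `g = γ α ^ m` with `γ` horocyclic and `α` the shift of labels, this is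
the portrait of `γ`, since the shift does not change the last letter. -/
noncomputable def portrait (g : affineGroup q) (v : Vertex q) : Equiv.Perm (Fin q) :=
  Equiv.ofBijective (fun t => (g.1 (v.child t)).last) <| by
    refine Function.Injective.bijective_of_finite fun s t h => ?_
    have hs : (g.1 (v.child s)).parent = (g.1 (v.child t)).parent := by
      rw [← affine_parent g.2, ← affine_parent g.2]; simp
    have h' : (g.1 (v.child s)).last = (g.1 (v.child t)).last := h
    have e : g.1 (v.child s) = g.1 (v.child t) := by
      rw [← Vertex.child_parent_last (g.1 (v.child s)), hs, h', Vertex.child_parent_last]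
    simpa using congrArg Vertex.last (g.1.injective e)

/-- The automaton rule. -/
lemma apply_child (g : affineGroup q) (v : Vertex q) (t : Fin q) :
    g.1 (v.child t) = (g.1 v).child (portrait g v t) := by
  have h : (g.1 (v.child t)).parent = g.1 v := by rw [← affine_parent g.2]; simp
  rw [← Vertex.child_parent_last (g.1 (v.child t)), h]
  rfl

lemma portrait_one (v : Vertex q) : portrait (1 : affineGroup q) v = 1 := by
  ext t : 1
  exact Vertex.last_child v t

lemma portrait_mul (g h : affineGroup q) (v : Vertex q) :
    portrait (g * h) v = portrait g (h.1 v) * portrait h v := by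
  ext t : 1
  change (g.1 (h.1 (v.child t))).last = portrait g (h.1 v) (portrait h v t)
  rw [apply_child h, apply_child g, Vertex.last_child]

/-- The discrete affine group `DA(𝕋)`: the affine transformations whose portrait is trivial at
all but finitely many vertices. -/
def DA (q : ℕ) [NeZero q] : Subgroup (affineGroup q) where
  carrier := {g | {v | portrait g v ≠ 1}.Finite}
  one_mem' := by simp [portrait_one]
  mul_mem' := by
    intro g h hg hh
    simp only [Set.mem_ofPred_eq] at *
    refine ((hg.preimage h.1.injective.injOn).union hh).subset fun v hv => ?_
    by_contra hcon
    simp only [Set.mem_union, Set.mem_preimage, Set.mem_ofPred_eq, not_or, not_not] at hcon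
    exact hv (by rw [portrait_mul, hcon.1, hcon.2, one_mul])
  inv_mem' := by
    intro g hg
    simp only [Set.mem_ofPred_eq] at *
    refine (hg.image g.1).subset fun v hv => ?_
    refine ⟨(g⁻¹).1 v, fun hcon => hv ?_, g.1.apply_symm_apply v⟩
    have h := portrait_mul g g⁻¹ v
    rw [mul_inv_cancel, portrait_one, hcon, one_mul] at h
    exact h.symm

/-! ### Random walks, isoperimetric profile, asymptotic comparison -/

/-- A probability measure on a (discrete) group is symmetric if `μ(g⁻¹) = μ(g)`. -/
def IsSymmetric {Γ : Type*} [Group Γ] (μ : PMF Γ) : Prop :=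
  ∀ g, μ g⁻¹ = μ g

/-- A probability measure on a group is non-degenerate if its support generates the whole group
as a semigroup. -/
def IsNondegenerate {Γ : Type*} [Group Γ] (μ : PMF Γ) : Prop :=
  Subsemigroup.closure μ.support = ⊤

/-- The `n`-fold convolution power: the law of `x₁ ⋯ xₙ` for independent `xᵢ` of law `μ`. -/
noncomputable def convPow {Γ : Type*} [Group Γ] (μ : PMF Γ) : ℕ → PMF Γ
  | 0 => PMF.pure 1
  | n + 1 => (convPow μ n).bind fun x => μ.map fun y => x * y

/-- The `L₁`-isoperimetric profile `Λ_{1,Γ,μ}(v)`: the infimum of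
`(1/2) ∑_{x,y} |f(x) - f(xy)| μ(y)` over functions `f` on `Γ` with at most `v` points in the
support and `‖f‖₁ = 1`. -/
noncomputable def isoProfile {Γ : Type*} [Group Γ] (μ : PMF Γ) (v : ℝ) : ℝ :=
  sInf {E : ℝ | ∃ f : Γ →₀ ℝ, (f.support.card : ℝ) ≤ v ∧ ∑ x ∈ f.support, |f x| = 1 ∧
    E = 1 / 2 * ∑' p : Γ × Γ, |f p.1 - f (p.1 * p.2)| * (μ p.2).toReal}

/-- `f ≲ g`: there are `C₁, C₂ > 0` with `f(t) ≤ C₁ g(C₂ t)` for all large enough `t`. -/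
def AsympLE (f g : ℝ → ℝ) : Prop :=
  ∃ C₁ : ℝ, 0 < C₁ ∧ ∃ C₂ : ℝ, 0 < C₂ ∧ ∀ᶠ t in atTop, f t ≤ C₁ * g (C₂ * t)

/-- `f ≃ g`: both `f ≲ g` and `g ≲ f`. -/
def AsympEquiv (f g : ℝ → ℝ) : Prop :=
  AsympLE f g ∧ AsympLE g f

end DiscreteAffine

/-! Both asymptotics express one fact: a set must have size doubly exponential in `k` before its
relative boundary can drop to order `1 / k`. Hence the profile at `v` is of order `1 / log log v`.
By Cheeger's inequality the walk then loses a fraction of order `1 / k²` of its L₂ norm per step,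
and taking `k` of order `log n` gives `exp (-n / (log n)²)`.

Large boundary. For each of the `q ^ k` descendants `v` of `ω(0)` at level `k`, consider the sign of
the portrait of `x` at `v`. Let `g` be a word of length `O(k)` carrying `ω(0)` to `v`, and let `κ`
be a fixed element that fixes level `0` pointwise and has there an odd portrait at `ω(0)` only.
Right multiplication by `g κ g⁻¹` flips the sign at `v` and preserves the signs at the other chosen
vertices. These directions behave like the edges of a hypercube of dimension `q ^ k`, so by
`card_inner_edges_le` a set of size at most `2 ^ (q ^ k / 2)` keeps at most half of them inside.
Each direction is a product of `O(k)` generators, whence a boundary of order at least `1 / k`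
(`setIso_of_flips`, `exists_setIso_two_step`). `SetIso.nash` and `SetIso.walkLaw_le` turn this into
decay of the return probability.

The decrease `‖u‖² - ‖Pu‖²` is the Dirichlet form of `P²`, not of `P`, so isoperimetry is proved for
the two-step walk. The walk may be periodic, hence only words of even length are used.

Small boundary. Take the `x` whose inverse has portrait in a finite box of size comparable to `k`
and whose level shift is at most `2k`. A generator on the right does not affect the box condition in
this range and moves the level by a bounded amount. A tent function of the level therefore has
Rayleigh quotients `O(1 / k)` in L₁ and `O(1 / k²)` in L₂, with doubly exponential support
(`exists_folnerFunction`). Its L₂ quotient bounds the return probability below by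
`le_walkLaw_of_test`. -/

namespace DiscreteAffine

/-! ### Entropy and edge-isoperimetry of the hypercube -/

lemma mul_log_two_le_log_one_add {s : ℝ} (h0 : 0 ≤ s) (h1 : s ≤ 1) :
    s * Real.log 2 ≤ Real.log (1 + s) := by
  have h := rpow_one_add_le_one_add_mul_self (s := 1) (p := s) (by norm_num) h0 h1
  rw [← Real.log_rpow (by norm_num)]
  refine Real.log_le_log (by positivity) ?_
  norm_num at h
  linarith

/-- This is the bound `2 p log 2` from below for the binary entropy at `p = a / (a + b) ≤ 1/2`. The
term in `a` gains `a log 2` because `a + b ≥ 2a`; the term in `b` gains the same amount by the chord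
bound for `log (1 + s)`. -/
lemma entropy_split_aux {a b : ℝ} (ha : 0 ≤ a) (hab : a ≤ b) :
    a * Real.log a + b * Real.log b + 2 * a * Real.log 2 ≤ (a + b) * Real.log (a + b) := by
  rcases ha.eq_or_lt with rfl | ha
  · simp
  have hb : 0 < b := ha.trans_le hab
  have h1 : Real.log a + Real.log 2 ≤ Real.log (a + b) := by
    rw [← Real.log_mul ha.ne' (by norm_num)]
    exact Real.log_le_log (by positivity) (by linarith)
  have h2 : Real.log b + a / b * Real.log 2 ≤ Real.log (a + b) := by
    have h := mul_log_two_le_log_one_add (s := a / b) (by positivity) ((div_le_one hb).2 hab)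
    have e : a + b = b * (1 + a / b) := by field_simp; ring
    rw [e, Real.log_mul hb.ne' (by positivity)]
    linarith
  have h3 := mul_le_mul_of_nonneg_left h1 ha.le
  have h4 := mul_le_mul_of_nonneg_left h2 hb.le
  have e : b * (Real.log b + a / b * Real.log 2) = b * Real.log b + a * Real.log 2 := by
    field_simp
  rw [e] at h4
  linarith

lemma entropy_split {a b : ℝ} (ha : 0 ≤ a) (hb : 0 ≤ b) :
    a * Real.log a + b * Real.log b + 2 * min a b * Real.log 2 ≤ (a + b) * Real.log (a + b) := by
  rcases le_total a b with h | h
  · rw [min_eq_left h]; exact entropy_split_aux ha h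
  · rw [min_eq_right h, add_comm a b]
    linarith [entropy_split_aux hb h]

/-- Edge-isoperimetry of the hypercube, for injective maps `T i`, each flipping its own
coordinate `χ i` and preserving the other ones. -/
lemma card_inner_edges_le {X ι : Type*} [DecidableEq X] (T : ι → X → X) (χ : ι → X → ℤˣ)
    (hT : ∀ i, Function.Injective (T i)) (I : Finset ι)
    (hflip : ∀ i ∈ I, ∀ x, χ i (T i x) = -χ i x)
    (hkeep : ∀ i ∈ I, ∀ j ∈ I, i ≠ j → ∀ x, χ i (T j x) = χ i x) (A : Finset X) :
    (∑ i ∈ I, ((A.filter fun x => T i x ∈ A).card : ℝ)) * Real.log 2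
      ≤ A.card * Real.log A.card := by
  classical
  induction I using Finset.induction_on generalizing A with
  | empty =>
    simp only [Finset.sum_empty, zero_mul]
    exact mul_nonneg (by positivity) (Real.log_natCast_nonneg _)
  | insert j I hj ih =>
    have ih' := ih (fun i hi => hflip i (Finset.mem_insert_of_mem hi))
      (fun i hi k hk => hkeep i (Finset.mem_insert_of_mem hi) k (Finset.mem_insert_of_mem hk))
    -- Split `A` by the sign of index `j`. The directions in `I` preserve both halves, while
    -- direction `j` exchanges the signs and so has at most `2 min |B| |C|` inner edges, which is
    -- what `entropy_split` pays for.
    set B := A.filter fun x => χ j x = 1 with hB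
    set C := A.filter fun x => ¬ χ j x = 1 with hC
    have hcard : (A.card : ℝ) = B.card + C.card := by
      rw [hB, hC]; exact_mod_cast (Finset.card_filter_add_card_filter_not _).symm
    have hj' : (A.filter fun x => T j x ∈ A).card ≤ 2 * min B.card C.card := by
      have hBC : (B.filter fun x => T j x ∈ A).card ≤ C.card := by
        refine Finset.card_le_card_of_injOn (T j) (fun x hx => ?_) (hT j).injOn
        simp only [hB, hC, Finset.coe_filter, Finset.mem_filter, Set.mem_ofPred_eq] at hx ⊢
        refine ⟨hx.2, ?_⟩
        rw [hflip j (Finset.mem_insert_self _ _), hx.1.2]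
        decide
      have hCB : (C.filter fun x => T j x ∈ A).card ≤ B.card := by
        refine Finset.card_le_card_of_injOn (T j) (fun x hx => ?_) (hT j).injOn
        simp only [hB, hC, Finset.coe_filter, Finset.mem_filter, Set.mem_ofPred_eq] at hx ⊢
        refine ⟨hx.2, ?_⟩
        rw [hflip j (Finset.mem_insert_self _ _), (Int.units_eq_one_or _).resolve_left hx.1.2]
        simp
      have h1 : (A.filter fun x => T j x ∈ A).card
          = (B.filter fun x => T j x ∈ A).card + (C.filter fun x => T j x ∈ A).card := by
        rw [hB, hC, Finset.filter_filter, Finset.filter_filter,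
          ← Finset.card_filter_add_card_filter_not (s := A.filter fun x => T j x ∈ A)
            (fun x => χ j x = 1), Finset.filter_filter, Finset.filter_filter]
        simp only [and_comm]
      have h2 := Finset.card_filter_le B fun x => T j x ∈ A
      have h3 := Finset.card_filter_le C fun x => T j x ∈ A
      omega
    have hsum : ∀ i ∈ I, ((A.filter fun x => T i x ∈ A).card : ℝ)
        = (B.filter fun x => T i x ∈ B).card + (C.filter fun x => T i x ∈ C).card := by
      intro i hi
      have hk : ∀ x, χ j (T i x) = χ j x := hkeep j (Finset.mem_insert_self _ _) i
        (Finset.mem_insert_of_mem hi) (fun h => hj (h ▸ hi))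
      have e1 : (B.filter fun x => T i x ∈ B)
          = (A.filter fun x => T i x ∈ A).filter fun x => χ j x = 1 := by
        ext x; simp only [hB, Finset.mem_filter, hk]; tauto
      have e2 : (C.filter fun x => T i x ∈ C)
          = (A.filter fun x => T i x ∈ A).filter fun x => ¬ χ j x = 1 := by
        ext x; simp only [hC, Finset.mem_filter, hk]; tauto
      rw [e1, e2]
      exact_mod_cast (Finset.card_filter_add_card_filter_not _).symm
    rw [Finset.sum_insert hj, Finset.sum_congr rfl hsum, Finset.sum_add_distrib]
    have hjr : ((A.filter fun x => T j x ∈ A).card : ℝ) ≤ 2 * min (B.card : ℝ) C.card := by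
      exact_mod_cast hj'
    have hl : 0 < Real.log 2 := Real.log_pos (by norm_num)
    have := entropy_split (a := B.card) (b := C.card) (by positivity) (by positivity)
    rw [hcard]
    have h1 := ih' B
    have h2 := ih' C
    have h3 := mul_le_mul_of_nonneg_right hjr hl.le
    linarith

/-! ### Dirichlet forms, level sets, Cheeger and Nash inequalities -/

section Analysis

variable {G : Type*} [Group G] {ι : Type*}

lemma finite_support_map₂ {X : Type*} {f g : X → ℝ} (hf : f.support.Finite) (hg : g.support.Finite)
    (F : ℝ → ℝ → ℝ) (hF : F 0 0 = 0) : (Function.support fun x => F (f x) (g x)).Finite := by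
  refine (hf.union hg).subset fun x hx => ?_
  by_contra h
  simp only [Set.mem_union, Function.mem_support, not_or, not_not] at h
  exact hx (by simp [h.1, h.2, hF])

lemma finite_support_map {X : Type*} {f : X → ℝ} (hf : f.support.Finite)
    (F : ℝ → ℝ) (hF : F 0 = 0) : (Function.support fun x => F (f x)).Finite :=
  finite_support_map₂ hf hf (fun a _ => F a) hF

lemma finite_support_shift {f : G → ℝ} (hf : f.support.Finite) (g : G) :
    (Function.support fun x => f (x * g)).Finite :=
  hf.preimage (mul_left_injective g).injOn

lemma summable_map₂ {X : Type*} {f g : X → ℝ} (hf : f.support.Finite) (hg : g.support.Finite)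
    (F : ℝ → ℝ → ℝ) (hF : F 0 0 = 0) : Summable fun x => F (f x) (g x) :=
  summable_of_hasFiniteSupport (finite_support_map₂ hf hg F hF)

lemma summable_map {X : Type*} {f : X → ℝ} (hf : f.support.Finite)
    (F : ℝ → ℝ) (hF : F 0 = 0) : Summable fun x => F (f x) :=
  summable_of_hasFiniteSupport (finite_support_map hf F hF)

lemma tsum_shift (f : G → ℝ) (g : G) : ∑' x, f (x * g) = ∑' x, f x :=
  (Equiv.mulRight g).tsum_eq f

/-- The total variation of `f` in the direction `g`. -/
noncomputable def variation (f : G → ℝ) (g : G) : ℝ := ∑' x, |f x - f (x * g)|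

lemma summable_variation {f : G → ℝ} (hf : f.support.Finite) (g : G) :
    Summable fun x => |f x - f (x * g)| :=
  summable_map₂ hf (finite_support_shift hf g) (fun a b => |a - b|) (by simp)

lemma variation_nonneg (f : G → ℝ) (g : G) : 0 ≤ variation f g :=
  tsum_nonneg fun _ => abs_nonneg _

/-- Triangle inequality through `x * g`, the second term being a translate of the variation in
direction `h`. This turns word length into a multiplicative loss. -/
lemma variation_mul_le {f : G → ℝ} (hf : f.support.Finite) (g h : G) :
    variation f (g * h) ≤ variation f g + variation f h := by
  have e : variation f h = ∑' x, |f (x * g) - f (x * g * h)| :=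
    (tsum_shift (fun x => |f x - f (x * h)|) g).symm
  have hs : Summable fun x => |f (x * g) - f (x * g * h)| :=
    summable_variation (f := f) hf h |>.comp_injective (mul_left_injective g)
  rw [e, variation, variation, ← (summable_variation hf g).tsum_add hs]
  refine (summable_variation hf _).tsum_le_tsum (fun x => ?_) ((summable_variation hf g).add hs)
  rw [← mul_assoc]
  exact abs_sub_le _ _ _

/-- The `L₁` Dirichlet form of the weighted family `s`. -/
noncomputable def energyOne (S : Finset ι) (s : ι → G) (w : ι → ℝ) (f : G → ℝ) : ℝ :=
  1 / 2 * ∑ i ∈ S, w i * variation f (s i)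

/-- The `L₂` Dirichlet form of the weighted family `s`. -/
noncomputable def energyTwo (S : Finset ι) (s : ι → G) (w : ι → ℝ) (f : G → ℝ) : ℝ :=
  1 / 2 * ∑ i ∈ S, w i * ∑' x, (f x - f (x * s i)) ^ 2

variable {S : Finset ι} {s : ι → G} {w : ι → ℝ}

lemma summable_sq_diff {f : G → ℝ} (hf : f.support.Finite) (g : G) :
    Summable fun x => (f x - f (x * g)) ^ 2 :=
  summable_map₂ hf (finite_support_shift hf g) (fun a b => (a - b) ^ 2) (by simp)

/-- Applying a contraction to the values decreases the `L₁` Dirichlet form. -/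
lemma energyOne_map_le (hw : ∀ i, 0 ≤ w i) {f : G → ℝ} (hf : f.support.Finite) (F : ℝ → ℝ)
    (h0 : F 0 = 0) (hF : ∀ a b, |F a - F b| ≤ |a - b|) :
    energyOne S s w (fun x => F (f x)) ≤ energyOne S s w f := by
  unfold energyOne
  gcongr with i
  · exact hw i
  · exact (summable_variation (finite_support_map hf F h0) _).tsum_le_tsum (fun x => hF _ _)
      (summable_variation hf _)

/-- Applying a contraction to the values decreases the `L₂` Dirichlet form. -/
lemma energyTwo_map_le (hw : ∀ i, 0 ≤ w i) {f : G → ℝ} (hf : f.support.Finite) (F : ℝ → ℝ)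
    (h0 : F 0 = 0) (hF : ∀ a b, |F a - F b| ≤ |a - b|) :
    energyTwo S s w (fun x => F (f x)) ≤ energyTwo S s w f := by
  unfold energyTwo
  refine mul_le_mul_of_nonneg_left (Finset.sum_le_sum fun i _ =>
    mul_le_mul_of_nonneg_left ?_ (hw i)) (by norm_num)
  exact (summable_sq_diff (finite_support_map hf F h0) _).tsum_le_tsum
      (fun x => sq_le_sq.2 (hF _ _)) (summable_sq_diff hf _)

/-- The isoperimetric inequality for sets of size at most `v`. -/
def SetIso (S : Finset ι) (s : ι → G) (w : ι → ℝ) (c v : ℝ) : Prop :=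
  ∀ A : Finset G, (A.card : ℝ) ≤ v →
    c * A.card ≤ energyOne S s w (Set.indicator (A : Set G) 1)

lemma SetIso.mono {c v v' : ℝ} (h : SetIso S s w c v) (hv : v' ≤ v) : SetIso S s w c v' :=
  fun A hA => h A (hA.trans hv)

/-- The isoperimetric inequality passes from sets to nonnegative functions, by decomposition
into level sets. -/
lemma SetIso.energyOne_ge {c v : ℝ} (h : SetIso S s w c v) :
    ∀ (n : ℕ) (f : G → ℝ) (hf : f.support.Finite), 0 ≤ f → hf.toFinset.card = n → (n : ℝ) ≤ v →
      c * ∑' x, f x ≤ energyOne S s w f := by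
  classical
  intro n
  induction n using Nat.strong_induction_on with
  | _ n ih =>
    intro f hf h0 hn hv
    set A := hf.toFinset with hA
    have hmem : ∀ x, x ∈ A ↔ f x ≠ 0 := fun x => by simp [hA]
    rcases A.eq_empty_or_nonempty with hAe | hAne
    · have : f = 0 := by
        ext x
        by_contra hx
        have := (hmem x).2 hx
        simp [hAe] at this
      subst this
      simp [energyOne, variation]
    · obtain ⟨a, ha, hmin⟩ := A.exists_min_image f hAne
      set t := f a with ht
      set k : G → ℝ := Set.indicator (A : Set G) 1 with hk
      have k1 : ∀ x ∈ A, k x = 1 := fun x hx => by simp [hk, hx]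
      have k0 : ∀ x, x ∉ A → k x = 0 := fun x hx => by simp [hk, hx]
      have f0 : ∀ x, x ∉ A → f x = 0 := fun x hx => by
        by_contra h'; exact hx ((hmem x).2 h')
      have tpos : 0 < t := lt_of_le_of_ne (h0 a) (Ne.symm ((hmem a).1 ha))
      have hkf : k.support.Finite := A.finite_toSet.subset fun x hx => by
        by_contra h'; exact hx (k0 x (by simpa using h'))
      set f' : G → ℝ := fun x => f x - t * k x with hf'
      have hf'f : f'.support.Finite := finite_support_map₂ hf hkf (fun a b => a - t * b) (by simp)
      have h0' : 0 ≤ f' := fun x => by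
        by_cases hx : x ∈ A
        · simp only [hf', k1 x hx, Pi.zero_apply]; linarith [hmin x hx]
        · simp [hf', k0 x hx, f0 x hx]
      have hlt : hf'f.toFinset.card < n := by
        rw [← hn]
        refine Finset.card_lt_card ⟨fun x hx => ?_, fun hsub => ?_⟩
        · by_contra h'
          simp [hf', k0 x h', f0 x h'] at hx
        · have := hsub ha
          simp [hf', k1 a ha, ← ht] at this
      have ih' := ih _ hlt f' hf'f h0' rfl ((Nat.cast_le.2 hlt.le).trans hv)
      -- The variations add up exactly: inside `A` the layer is constant, and across the boundary of
      -- `A` both summands change in the same direction.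
      have hvar : ∀ g, variation f g = t * variation k g + variation f' g := by
        intro g
        rw [variation, variation, variation, ← tsum_mul_left,
          ← ((summable_variation hkf g).mul_left t).tsum_add (summable_variation hf'f g)]
        refine tsum_congr fun x => ?_
        by_cases hx : x ∈ A <;> by_cases hy : x * g ∈ A
        · simp [hf', k1 x hx, k1 _ hy]
        · simp only [hf', k1 x hx, k0 _ hy, f0 _ hy]
          have := hmin x hx
          rw [abs_of_nonneg (by linarith), abs_of_nonneg (by linarith),
            abs_of_nonneg (by linarith)]
          ring
        · simp only [hf', k0 x hx, k1 _ hy, f0 _ hx]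
          have := hmin _ hy
          rw [abs_of_nonpos (by linarith), abs_of_nonpos (by linarith),
            abs_of_nonpos (by linarith)]
          ring
        · simp [hf', k0 x hx, k0 _ hy]
      have hE : energyOne S s w f = t * energyOne S s w k + energyOne S s w f' := by
        simp only [energyOne, hvar, mul_add, Finset.sum_add_distrib, Finset.mul_sum]
        congr 1
        exact Finset.sum_congr rfl fun i _ => by ring
      have hsum : ∑' x, f x = t * A.card + ∑' x, f' x := by
        have h1 : ∑' x, k x = A.card := by
          rw [tsum_eq_sum (s := A) (fun x hx => k0 x hx), Finset.sum_congr rfl k1]; simp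
        rw [← h1, ← tsum_mul_left, ← ((summable_map hkf (fun a => t * a) (by simp))).tsum_add
          (summable_map hf'f (fun a => a) rfl)]
        exact tsum_congr fun x => by simp [hf']
      have hAiso := h A (by rw [hn]; exact hv)
      rw [hE, hsum]
      have := mul_le_mul_of_nonneg_left hAiso tpos.le
      linarith

lemma SetIso.energyOne_ge_abs {c v : ℝ} (h : SetIso S s w c v) (hw : ∀ i, 0 ≤ w i)
    {f : G → ℝ} (hf : f.support.Finite) (hv : (hf.toFinset.card : ℝ) ≤ v) :
    c * ∑' x, |f x| ≤ energyOne S s w f := by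
  have hf' := finite_support_map hf abs (by simp)
  refine (h.energyOne_ge _ (fun x => |f x|) hf' (fun x => abs_nonneg _) rfl ?_).trans
    (energyOne_map_le hw hf abs (by simp) fun a b => abs_abs_sub_abs_le _ _)
  refine le_trans (Nat.cast_le.2 (Finset.card_le_card fun x hx => ?_)) hv
  simpa using hx

/-- Cheeger's inequality. -/
lemma SetIso.energyTwo_ge {c v : ℝ} (h : SetIso S s w c v) (hc : 0 < c) (hw : ∀ i, 0 ≤ w i)
    (hw1 : ∑ i ∈ S, w i = 1)
    {f : G → ℝ} (hf : f.support.Finite) (h0 : 0 ≤ f) (hv : (hf.toFinset.card : ℝ) ≤ v) :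
    c ^ 2 / 2 * ∑' x, f x ^ 2 ≤ energyTwo S s w f := by
  have hf2 := finite_support_map hf (fun a => a ^ 2) (by simp)
  have h1 : c * ∑' x, f x ^ 2 ≤ energyOne S s w (fun x => f x ^ 2) := by
    refine h.energyOne_ge _ (fun x => f x ^ 2) hf2 (fun x => sq_nonneg _) rfl ?_
    refine le_trans (Nat.cast_le.2 (Finset.card_le_card fun x hx => ?_)) hv
    simpa using hx
  -- With `d = |a - b|`, this is `d (a + b) ≤ d² / c + (c / 2)(a² + b²)` summed over `x`. The weight
  -- is chosen so that the last term absorbs only half of the lower bound in `h1`.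
  have hvar : ∀ g, variation (fun x => f x ^ 2) g
      ≤ 1 / c * ∑' x, (f x - f (x * g)) ^ 2 + c * ∑' x, f x ^ 2 := by
    intro g
    have hfg := finite_support_shift hf g
    have e : ∑' x, f x ^ 2 = 1 / 2 * ∑' x, (f x ^ 2 + f (x * g) ^ 2) := by
      rw [(summable_map hf (fun a => a ^ 2) (by simp)).tsum_add
        (summable_map hfg (fun a => a ^ 2) (by simp)), tsum_shift (fun x => f x ^ 2) g]
      ring
    rw [e, ← tsum_mul_left, ← tsum_mul_left, ← tsum_mul_left, variation,
      ← ((summable_sq_diff hf g).mul_left _).tsum_add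
        (((summable_map₂ hf hfg (fun a b => a ^ 2 + b ^ 2) (by simp)).mul_left _).mul_left _)]
    refine (summable_variation hf2 g).tsum_le_tsum (fun x => ?_)
      (((summable_sq_diff hf g).mul_left _).add
        (((summable_map₂ hf hfg (fun a b => a ^ 2 + b ^ 2) (by simp)).mul_left _).mul_left _))
    have ha := h0 x
    have hb := h0 (x * g)
    simp only [Pi.zero_apply] at ha hb
    set a := f x
    set b := f (x * g)
    have e1 : |a ^ 2 - b ^ 2| = |a - b| * (a + b) := by
      rw [show a ^ 2 - b ^ 2 = (a - b) * (a + b) by ring, abs_mul, abs_of_nonneg (add_nonneg ha hb)]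
    have e2 : (a - b) ^ 2 = |a - b| ^ 2 := (sq_abs _).symm
    rw [e1, e2]
    set d := |a - b|
    have e3 : 1 / c * d ^ 2 + c * (1 / 2 * (a ^ 2 + b ^ 2)) - d * (a + b)
        = 1 / c * (d - c / 2 * (a + b)) ^ 2 + c / 4 * (a - b) ^ 2 := by
      field_simp; ring
    have : 0 ≤ 1 / c * (d - c / 2 * (a + b)) ^ 2 + c / 4 * (a - b) ^ 2 := by positivity
    linarith
  have h2 : energyOne S s w (fun x => f x ^ 2)
      ≤ 1 / c * energyTwo S s w f + 1 / 2 * (c * ∑' x, f x ^ 2) := by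
    have : ∑ i ∈ S, w i * variation (fun x => f x ^ 2) (s i)
        ≤ ∑ i ∈ S, (1 / c * (w i * ∑' x, (f x - f (x * s i)) ^ 2)
          + w i * (c * ∑' x, f x ^ 2)) := by
      refine Finset.sum_le_sum fun i _ => ?_
      have := mul_le_mul_of_nonneg_left (hvar (s i)) (hw i)
      linarith
    rw [Finset.sum_add_distrib, ← Finset.mul_sum, ← Finset.sum_mul, hw1] at this
    unfold energyOne energyTwo
    linarith
  have h3 : c / 2 * ∑' x, f x ^ 2 ≤ 1 / c * energyTwo S s w f := by linarith
  have h4 := mul_le_mul_of_nonneg_left h3 hc.le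
  have e : c * (1 / c * energyTwo S s w f) = energyTwo S s w f := by field_simp
  rw [e] at h4
  linarith

/-- A Nash-type inequality: truncation reduces it to small supports. -/
lemma SetIso.nash {c v : ℝ} (h : SetIso S s w c v) (hc : 0 < c) (hw : ∀ i, 0 ≤ w i)
    (hw1 : ∑ i ∈ S, w i = 1) {u : G → ℝ} (hu : u.support.Finite) (h0 : 0 ≤ u)
    (hu1 : ∑' x, u x = 1) (hpos : 0 < ∑' x, u x ^ 2) (hv : 4 / (∑' x, u x ^ 2) ≤ v) :
    c ^ 2 / 4 * ∑' x, u x ^ 2 ≤ energyTwo S s w u := by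
  set b := ∑' x, u x ^ 2 with hb
  -- At most `1 / t = 4 / b` points satisfy `u ≥ t`, because `u` has mass `1`. Since `(u - t)₊² ≥ u²
  -- - 2 t u`, the truncation still keeps `b - 2t = b / 2` of the squared norm.
  set t := b / 4 with ht
  have tpos : 0 < t := by positivity
  set F : ℝ → ℝ := fun a => max (a - t) 0 with hF
  have hF0 : F 0 = 0 := by simp [hF, tpos.le]
  have hFu := finite_support_map hu F hF0
  have hcard : (hFu.toFinset.card : ℝ) ≤ v := by
    refine le_trans ?_ hv
    have hsub : ∀ x ∈ hFu.toFinset, t ≤ u x := by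
      intro x hx
      by_contra hlt
      push Not at hlt
      simp only [Set.Finite.mem_toFinset, Function.mem_support, hF] at hx
      exact hx (max_eq_right (by linarith))
    have h1 : (hFu.toFinset.card : ℝ) * t ≤ 1 := by
      rw [← hu1, ← nsmul_eq_mul]
      exact (Finset.card_nsmul_le_sum _ _ _ hsub).trans
        ((summable_map hu (fun a => a) rfl).sum_le_tsum _ fun x _ => h0 x)
    rw [show 4 / b = 1 / t by rw [ht]; field_simp]
    rw [le_div_iff₀ tpos]; exact h1
  have hch := h.energyTwo_ge hc hw hw1 hFu (fun x => le_max_right _ _) hcard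
  have hle := energyTwo_map_le (S := S) (s := s) hw hu F hF0 (fun a b => by
    refine (abs_max_sub_max_le_abs _ _ _).trans ?_
    simp)
  have hnorm : b / 2 ≤ ∑' x, F (u x) ^ 2 := by
    have e : b / 2 = ∑' x, (u x ^ 2 - 2 * t * u x) := by
      rw [(summable_map hu (fun a => a ^ 2) (by simp)).tsum_sub
        (summable_map hu (fun a => 2 * t * a) (by simp)), tsum_mul_left, hu1, ← hb, ht]
      ring
    rw [e]
    refine (summable_map hu (fun a => a ^ 2 - 2 * t * a) (by simp)).tsum_le_tsum (fun x => ?_)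
      (summable_map hu (fun a => F a ^ 2) (by simp [hF0]))
    have hx := h0 x
    simp only [Pi.zero_apply] at hx
    rcases le_total t (u x) with h' | h'
    · simp only [hF, max_eq_left (sub_nonneg.2 h')]; nlinarith
    · simp only [hF, max_eq_right (sub_nonpos.2 h')]; nlinarith
  have := mul_le_mul_of_nonneg_left hnorm (show 0 ≤ c ^ 2 / 2 by positivity)
  linarith

end Analysis

/-! ### Upper and lower bounds for return probabilities -/

section Walk

variable {G : Type*} [Group G] {ι : Type*}

/-- The Markov operator of the random walk with weights `w` on the finite set `S`. -/
noncomputable def average (S : Finset G) (w : G → ℝ) (f : G → ℝ) : G → ℝ :=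
  fun x => ∑ y ∈ S, w y * f (x * y)

variable {S : Finset G} {w : G → ℝ}

lemma finite_support_average {f : G → ℝ} (hf : f.support.Finite) :
    (average S w f).support.Finite := by
  refine (S.finite_toSet.biUnion fun y _ => finite_support_shift hf y).subset fun x hx => ?_
  obtain ⟨y, hy, h⟩ := Finset.exists_ne_zero_of_sum_ne_zero hx
  exact Set.mem_biUnion hy (right_ne_zero_of_mul h)

lemma finite_support_average_iterate {f : G → ℝ} (hf : f.support.Finite) (n : ℕ) :
    ((average S w)^[n] f).support.Finite := by
  induction n with
  | zero => exact hf
  | succ n ih => rw [Function.iterate_succ_apply']; exact finite_support_average ih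

lemma average_nonneg (hw : ∀ y, 0 ≤ w y) {f : G → ℝ} (hf : 0 ≤ f) : 0 ≤ average S w f :=
  fun _ => Finset.sum_nonneg fun y _ => mul_nonneg (hw y) (hf _)

lemma average_iterate_nonneg (hw : ∀ y, 0 ≤ w y) {f : G → ℝ} (hf : 0 ≤ f) (n : ℕ) :
    0 ≤ (average S w)^[n] f := by
  induction n with
  | zero => exact hf
  | succ n ih => rw [Function.iterate_succ_apply']; exact average_nonneg hw ih

lemma tsum_average_mul {f g : G → ℝ} (hg : g.support.Finite) :
    ∑' x, average S w f x * g x = ∑ y ∈ S, w y * ∑' x, f (x * y) * g x := by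
  have hs : ∀ y, Summable fun x => w y * (f (x * y) * g x) := fun y =>
    summable_of_hasFiniteSupport (hg.subset fun x hx => by
      intro h; exact hx (by simp [h]))
  simp only [average, Finset.sum_mul, ← tsum_mul_left]
  rw [← Summable.tsum_finsetSum fun y _ => hs y]
  exact tsum_congr fun x => Finset.sum_congr rfl fun y _ => by ring

lemma tsum_average (hw1 : ∑ y ∈ S, w y = 1) {f : G → ℝ} (hf : f.support.Finite) :
    ∑' x, average S w f x = ∑' x, f x := by
  simp only [average]
  rw [Summable.tsum_finsetSum fun y _ =>
    summable_map (finite_support_shift hf y) (fun a => w y * a) (by simp)]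
  simp only [tsum_mul_left, tsum_shift]
  rw [← Finset.sum_mul, hw1, one_mul]

lemma tsum_average_iterate (hw1 : ∑ y ∈ S, w y = 1) {f : G → ℝ} (hf : f.support.Finite) (n : ℕ) :
    ∑' x, (average S w)^[n] f x = ∑' x, f x := by
  induction n with
  | zero => rfl
  | succ n ih =>
    rw [Function.iterate_succ_apply', tsum_average hw1 (finite_support_average_iterate hf n), ih]

/-- Translating the sum by `y` replaces the step `y` by `y⁻¹`, which has the same weight. -/
lemma average_adjoint (hS : ∀ y ∈ S, y⁻¹ ∈ S) (hws : ∀ y, w y⁻¹ = w y) {f g : G → ℝ}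
    (hf : f.support.Finite) (hg : g.support.Finite) :
    ∑' x, average S w f x * g x = ∑' x, f x * average S w g x := by
  simp only [fun x => mul_comm (f x) (average S w g x)]
  rw [tsum_average_mul hg, tsum_average_mul hf]
  refine Finset.sum_nbij' (fun y => y⁻¹) (fun y => y⁻¹) hS hS (by simp) (by simp) fun y _ => ?_
  rw [hws, ← tsum_shift (fun x => g (x * y⁻¹) * f x) y]
  simp only [mul_inv_cancel_right, mul_comm]

lemma energyTwo_eq {T : Finset ι} {s : ι → G} {m : ι → ℝ} (hm : ∑ i ∈ T, m i = 1) {f : G → ℝ}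
    (hf : f.support.Finite) :
    energyTwo T s m f = ∑' x, f x ^ 2 - ∑ i ∈ T, m i * ∑' x, f (x * s i) * f x := by
  have h : ∀ i, ∑' x, (f x - f (x * s i)) ^ 2
      = 2 * ∑' x, f x ^ 2 - 2 * ∑' x, f (x * s i) * f x := by
    intro i
    have hfi := finite_support_shift hf (s i)
    have e : 2 * ∑' x, f x ^ 2 = ∑' x, (f x ^ 2 + f (x * s i) ^ 2) := by
      rw [(summable_map hf (fun a => a ^ 2) (by simp)).tsum_add
        (summable_map hfi (fun a => a ^ 2) (by simp)), tsum_shift (fun x => f x ^ 2)]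
      ring
    rw [e, ← tsum_mul_left, ← (summable_map₂ hf hfi (fun a b => a ^ 2 + b ^ 2) (by simp)).tsum_sub
      (summable_map₂ hf hfi (fun a b => 2 * (b * a)) (by simp))]
    exact tsum_congr fun x => by ring
  simp only [energyTwo, h, mul_sub, Finset.sum_sub_distrib]
  rw [← Finset.sum_mul, hm, one_mul]
  simp only [mul_left_comm _ (2 : ℝ)]
  rw [← Finset.mul_sum]
  ring

lemma energyTwo_eq_sub_average (hw1 : ∑ y ∈ S, w y = 1) {f : G → ℝ} (hf : f.support.Finite) :
    energyTwo S id w f = ∑' x, f x ^ 2 - ∑' x, average S w f x * f x := by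
  rw [energyTwo_eq hw1 hf, tsum_average_mul hf]
  rfl

/-- The Dirichlet form of the two-step walk measures the decay of the `L₂` norm. -/
lemma energyTwo_two_step (hS : ∀ y ∈ S, y⁻¹ ∈ S) (hws : ∀ y, w y⁻¹ = w y)
    (hw1 : ∑ y ∈ S, w y = 1) {f : G → ℝ} (hf : f.support.Finite) :
    energyTwo (S ×ˢ S) (fun p => p.1 * p.2) (fun p => w p.1 * w p.2) f
      = ∑' x, f x ^ 2 - ∑' x, average S w f x ^ 2 := by
  rw [energyTwo_eq _ hf]
  · congr 1
    simp only [sq]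
    rw [← average_adjoint hS hws (finite_support_average hf) hf,
      tsum_average_mul hf, Finset.sum_product]
    refine Finset.sum_congr rfl fun y _ => ?_
    have : ∑' x, average S w f (x * y) * f x
        = ∑ z ∈ S, w z * ∑' x, f (x * y * z) * f x := by
      simp only [average, Finset.sum_mul, ← tsum_mul_left]
      rw [← Summable.tsum_finsetSum fun z _ =>
        summable_map₂ (finite_support_shift (finite_support_shift hf z) y) hf
          (fun a b => w z * (a * b)) (by simp)]
      exact tsum_congr fun x => Finset.sum_congr rfl fun y _ => by ring
    rw [this, Finset.mul_sum]
    exact Finset.sum_congr rfl fun z _ => by simp only [mul_assoc]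
  · rw [Finset.sum_product]
    simp only [← Finset.mul_sum, hw1, mul_one]

lemma tsum_sq_nonneg {X : Type*} (f : X → ℝ) : 0 ≤ ∑' x, f x ^ 2 := tsum_nonneg fun _ => sq_nonneg _

lemma tsum_mul_sq_le {X : Type*} {f g : X → ℝ} (hf : f.support.Finite) (hg : g.support.Finite) :
    (∑' x, f x * g x) ^ 2 ≤ (∑' x, f x ^ 2) * ∑' x, g x ^ 2 := by
  classical
  set U := hf.toFinset ∪ hg.toFinset
  have h : ∀ F : ℝ → ℝ → ℝ, F 0 0 = 0 → ∑' x, F (f x) (g x) = ∑ x ∈ U, F (f x) (g x) := by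
    intro F hF
    refine tsum_eq_sum fun x hx => ?_
    simp only [U, Finset.mem_union, Set.Finite.mem_toFinset, Function.mem_support, not_or,
      not_not] at hx
    rw [hx.1, hx.2, hF]
  rw [h (fun a b => a * b) (by simp), h (fun a _ => a ^ 2) (by simp),
    h (fun _ b => b ^ 2) (by simp)]
  exact Finset.sum_mul_sq_le_sq_mul_sq _ _ _

/-- The law of the walk at time `n`. -/
noncomputable def walkLaw (S : Finset G) (w : G → ℝ) (n : ℕ) : G → ℝ :=
  (average S w)^[n] (Set.indicator {1} 1)

lemma walkLaw_succ (n : ℕ) : walkLaw S w (n + 1) = average S w (walkLaw S w n) :=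
  Function.iterate_succ_apply' _ _ _

lemma finite_support_walkLaw (n : ℕ) : (walkLaw S w n).support.Finite :=
  finite_support_average_iterate ((Set.finite_singleton (1 : G)).subset
    Set.support_indicator_subset) n

lemma walkLaw_nonneg (hw : ∀ y, 0 ≤ w y) (n : ℕ) : 0 ≤ walkLaw S w n :=
  average_iterate_nonneg hw (fun _ => Set.indicator_nonneg (by simp) _) n

lemma tsum_walkLaw (hw1 : ∑ y ∈ S, w y = 1) (n : ℕ) : ∑' x, walkLaw S w n x = 1 := by
  rw [walkLaw, tsum_average_iterate hw1 ((Set.finite_singleton (1 : G)).subset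
    Set.support_indicator_subset), tsum_eq_single 1 (fun x hx => by simp [hx])]
  simp

/-- Self-adjointness moves `n` of the `2n` steps onto the other factor of the pairing with the point
mass at `1`. -/
lemma walkLaw_two_mul_one (hS : ∀ y ∈ S, y⁻¹ ∈ S) (hws : ∀ y, w y⁻¹ = w y) (n : ℕ) :
    walkLaw S w (2 * n) 1 = ∑' x, walkLaw S w n x ^ 2 := by
  have key : ∀ k m, ∑' x, walkLaw S w (m + k) x * walkLaw S w 0 x
      = ∑' x, walkLaw S w m x * walkLaw S w k x := by
    intro k
    induction k with
    | zero => intro m; rfl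
    | succ k ih =>
      intro m
      rw [← add_assoc, add_right_comm, ih (m + 1), walkLaw_succ, walkLaw_succ]
      exact average_adjoint hS hws (finite_support_walkLaw _) (finite_support_walkLaw _)
  have h := key n n
  rw [tsum_eq_single 1 (fun x hx => by simp [walkLaw, hx])] at h
  rw [two_mul]
  simpa [walkLaw, sq] using h

/-- As long as the squared norm exceeds `4 / v`, the Nash inequality applies and each step
multiplies it by at most `1 - c² / 4`. Once below `4 / v` it stays there, since the squared norms do
not increase. -/
lemma SetIso.walkLaw_le {c v : ℝ}
    (h : SetIso (S ×ˢ S) (fun p => p.1 * p.2) (fun p => w p.1 * w p.2) c v)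
    (hc : 0 < c) (hc1 : c ≤ 1) (hv : 0 < v)
    (hS : ∀ y ∈ S, y⁻¹ ∈ S) (hws : ∀ y, w y⁻¹ = w y) (hw : ∀ y, 0 ≤ w y)
    (hw1 : ∑ y ∈ S, w y = 1) (n : ℕ) :
    walkLaw S w (2 * n) 1 ≤ max (4 / v) ((1 - c ^ 2 / 4) ^ n) := by
  rw [walkLaw_two_mul_one hS hws]
  set b : ℕ → ℝ := fun n => ∑' x, walkLaw S w n x ^ 2 with hb
  change b n ≤ _
  have hE : ∀ n, energyTwo (S ×ˢ S) (fun p => p.1 * p.2) (fun p => w p.1 * w p.2) (walkLaw S w n)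
      = b n - b (n + 1) := fun n => by
    rw [energyTwo_two_step hS hws hw1 (finite_support_walkLaw n), ← walkLaw_succ]
  have hr : 0 ≤ 1 - c ^ 2 / 4 := by nlinarith
  induction n with
  | zero =>
    refine le_max_of_le_right (le_of_eq ?_)
    simp only [hb, walkLaw, Function.iterate_zero, id]
    rw [tsum_eq_single 1 (fun x hx => by simp [hx])]
    simp
  | succ n ih =>
    have hanti : b (n + 1) ≤ b n := by
      have h0 : 0 ≤ energyTwo (S ×ˢ S) (fun p => p.1 * p.2) (fun p => w p.1 * w p.2)
          (walkLaw S w n) := by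
        unfold energyTwo
        exact mul_nonneg (by norm_num) (Finset.sum_nonneg fun p _ =>
          mul_nonneg (mul_nonneg (hw _) (hw _)) (tsum_nonneg fun _ => sq_nonneg _))
      rw [hE] at h0; linarith
    rcases le_or_gt (b (n + 1)) (4 / v) with h1 | h1
    · exact le_max_of_le_left h1
    · have hbn : 4 / v < b n := h1.trans_le hanti
      have hbpos : 0 < b n := lt_trans (by positivity) hbn
      refine le_max_of_le_right ?_
      have ih' := (le_max_iff.1 ih).resolve_left (not_le.2 hbn)
      have hn := h.nash hc (fun p => mul_nonneg (hw _) (hw _))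
        (by rw [Finset.sum_product]; simp only [← Finset.mul_sum, hw1, mul_one])
        (finite_support_walkLaw n) (walkLaw_nonneg hw n) (tsum_walkLaw hw1 n) hbpos
        (by
          rw [div_lt_iff₀ hv] at hbn
          rw [div_le_iff₀ hbpos]; linarith)
      rw [hE] at hn
      have : b (n + 1) ≤ (1 - c ^ 2 / 4) * b n := by
        have : c ^ 2 / 4 * b n ≤ b n - b (n + 1) := hn
        linarith
      rw [pow_succ']
      exact this.trans (mul_le_mul_of_nonneg_left ih' hr)

/-- The walk commutes with left translations, so starting from `f` superposes translates of the walk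
started at a point. -/
lemma average_iterate_apply {f : G → ℝ} (hf : f.support.Finite) (n : ℕ) (x : G) :
    (average S w)^[n] f x = ∑ h ∈ hf.toFinset, f h * walkLaw S w n (h⁻¹ * x) := by
  induction n generalizing x with
  | zero =>
    simp only [walkLaw, Function.iterate_zero, id]
    by_cases hx : x ∈ hf.toFinset
    · rw [Finset.sum_eq_single_of_mem x hx]
      · simp
      · intro b _ hb
        rw [Set.indicator_of_notMem, mul_zero]
        rw [Set.mem_singleton_iff, inv_mul_eq_one]; exact hb
    · rw [Finset.sum_eq_zero]
      · simpa using hx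
      · intro b hb'
        rw [Set.indicator_of_notMem, mul_zero]
        rw [Set.mem_singleton_iff, inv_mul_eq_one]; rintro rfl; exact hx hb'
  | succ n ih =>
    rw [Function.iterate_succ_apply', walkLaw_succ]
    simp only [average, ih, Finset.mul_sum]
    rw [Finset.sum_comm]
    refine Finset.sum_congr rfl fun h _ => Finset.sum_congr rfl fun y _ => ?_
    rw [mul_assoc]; ring

/-- Young's inequality for the walk started from a nonnegative finitely supported function. -/
lemma tsum_average_iterate_sq_le {f : G → ℝ} (hf : f.support.Finite)
    (h0 : 0 ≤ f) (n : ℕ) :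
    ∑' x, (average S w)^[n] f x ^ 2 ≤ (∑' x, f x) ^ 2 * ∑' x, walkLaw S w n x ^ 2 := by
  have hsum : ∑' x, f x = ∑ h ∈ hf.toFinset, f h :=
    tsum_eq_sum fun x hx => by simpa using hx
  have htr : ∀ h : G, Summable fun x => walkLaw S w n (h⁻¹ * x) ^ 2 := fun h =>
    (summable_map (finite_support_walkLaw n) (fun a => a ^ 2) (by simp)).comp_injective
      (mul_right_injective h⁻¹)
  -- Cauchy–Schwarz for the weights `f h`, whose total mass is `∑ f`.
  have hpt : ∀ x, (average S w)^[n] f x ^ 2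
      ≤ ∑ h ∈ hf.toFinset, (∑' x, f x) * f h * walkLaw S w n (h⁻¹ * x) ^ 2 := by
    intro x
    rw [average_iterate_apply hf, hsum]
    simp only [mul_assoc]
    rw [← Finset.mul_sum]
    refine Finset.sum_sq_le_sum_mul_sum_of_sq_le_mul _ (fun h _ => h0 h)
      (fun h _ => mul_nonneg (h0 h) (sq_nonneg _)) fun h _ => le_of_eq (by ring)
  refine ((summable_map (finite_support_average_iterate hf n) (fun a => a ^ 2)
    (by simp)).tsum_le_tsum hpt (summable_sum fun h _ => (htr h).mul_left _)).trans (le_of_eq ?_)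
  rw [Summable.tsum_finsetSum fun h _ => (htr h).mul_left _]
  have : ∀ h : G, ∑' x, walkLaw S w n (h⁻¹ * x) ^ 2 = ∑' x, walkLaw S w n x ^ 2 := fun h =>
    (Equiv.mulLeft h⁻¹).tsum_eq fun x => walkLaw S w n x ^ 2
  simp only [tsum_mul_left, this]
  rw [← Finset.sum_mul, ← Finset.mul_sum, ← hsum]
  ring

/-- Lower bound for the return probability by a test function. -/
lemma le_walkLaw_of_test (hS : ∀ y ∈ S, y⁻¹ ∈ S) (hws : ∀ y, w y⁻¹ = w y)
    (hw1 : ∑ y ∈ S, w y = 1) {f : G → ℝ} (hf : f.support.Finite) (h0 : 0 ≤ f)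
    (hpos : 0 < ∑' x, f x ^ 2) {ε : ℝ} (hε1 : ε ≤ 1)
    (hε : energyTwo S id w f ≤ ε * ∑' x, f x ^ 2) (n : ℕ) :
    (1 - ε) ^ (2 * n) / hf.toFinset.card ≤ walkLaw S w (2 * n) 1 := by
  rw [walkLaw_two_mul_one hS hws]
  set N : ℕ → ℝ := fun j => ∑' x, (average S w)^[j] f x ^ 2 with hN
  have hN0 : ∀ j, 0 ≤ N j := fun j => tsum_sq_nonneg _
  have hfj := fun j => finite_support_average_iterate (S := S) (w := w) hf j
  have hρ : 0 ≤ 1 - ε := by linarith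
  have hstart : (1 - ε) ^ 2 * N 0 ≤ N 1 := by
    rw [energyTwo_eq_sub_average hw1 hf] at hε
    have h1 : (1 - ε) * N 0 ≤ ∑' x, average S w f x * f x := by
      have : N 0 = ∑' x, f x ^ 2 := rfl
      rw [this]; linarith
    have h2 : (∑' x, average S w f x * f x) ^ 2 ≤ N 1 * N 0 :=
      tsum_mul_sq_le (finite_support_average hf) hf
    have h3 : ((1 - ε) * N 0) ^ 2 ≤ N 1 * N 0 :=
      (pow_le_pow_left₀ (mul_nonneg hρ (hN0 0)) h1 2).trans h2
    have h4 : 0 < N 0 := hpos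
    nlinarith
  -- Log-convexity of `j ↦ ‖P^j f‖²`: by self-adjointness `‖P^(j+1) f‖²` is the pairing of `P^j f`
  -- with `P^(j+2) f`. The first ratio then bounds all later ones from below, as the spectral
  -- theorem would show.
  have hconv : ∀ j, N (j + 1) ^ 2 ≤ N j * N (j + 2) := by
    intro j
    have e : N (j + 1) = ∑' x, (average S w)^[j] f x * (average S w)^[j + 2] f x := by
      simp only [hN, sq]
      rw [Function.iterate_succ_apply' _ (j + 1), ← average_adjoint hS hws (hfj j) (hfj (j + 1)),
        ← Function.iterate_succ_apply' (average S w) j]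
    rw [e]
    exact tsum_mul_sq_le (hfj j) (hfj (j + 2))
  have hstep : ∀ j, (1 - ε) ^ 2 * N j ≤ N (j + 1) := by
    intro j
    induction j with
    | zero => exact hstart
    | succ j ih =>
      rcases (hN0 j).eq_or_lt with h | h
      · have h1 := hconv j
        rw [← h, zero_mul] at h1
        have h2 : N (j + 1) = 0 := by nlinarith [sq_nonneg (N (j + 1))]
        rw [h2, mul_zero]; exact hN0 _
      · have h1 := hconv j
        have h2 := mul_le_mul_of_nonneg_right ih (hN0 (j + 1))
        have h3 : N j * ((1 - ε) ^ 2 * N (j + 1)) ≤ N j * N (j + 2) := by nlinarith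
        exact le_of_mul_le_mul_left h3 h
  have hpow : (1 - ε) ^ (2 * n) * N 0 ≤ N n := by
    rw [pow_mul]
    induction n with
    | zero => simp
    | succ n ih =>
      rw [pow_succ', mul_assoc]
      exact (mul_le_mul_of_nonneg_left ih (sq_nonneg _)).trans (hstep n)
  -- Young's inequality compares `N n` with `‖f‖₁²` times the return probability; Cauchy–Schwarz on
  -- the support then trades `‖f‖₁²` for the size of the support times `N 0`.
  have hY : N n ≤ (∑' x, f x) ^ 2 * ∑' x, walkLaw S w n x ^ 2 :=
    tsum_average_iterate_sq_le hf h0 n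
  have hCS : (∑' x, f x) ^ 2 ≤ hf.toFinset.card * N 0 := by
    have e1 : ∑' x, f x = ∑ h ∈ hf.toFinset, f h := tsum_eq_sum fun x hx => by simpa using hx
    have e2 : N 0 = ∑ h ∈ hf.toFinset, f h ^ 2 :=
      tsum_eq_sum fun x hx => by simpa using hx
    rw [e1, e2]
    exact sq_sum_le_card_mul_sum_sq
  have hb := tsum_sq_nonneg (walkLaw S w n)
  have h4 : 0 < N 0 := hpos
  have hcard : (0 : ℝ) < hf.toFinset.card := by
    refine Nat.cast_pos.2 (Finset.card_pos.2 ?_)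
    by_contra hne
    rw [Finset.not_nonempty_iff_eq_empty] at hne
    have : N 0 = ∑ h ∈ hf.toFinset, f h ^ 2 :=
      tsum_eq_sum fun x hx => by simpa using hx
    rw [hne, Finset.sum_empty] at this
    linarith
  rw [div_le_iff₀ hcard]
  have h5 := mul_le_mul_of_nonneg_right hCS hb
  refine le_of_mul_le_mul_right ?_ h4
  linarith

/-- The weights of a finitely supported measure compute its convolution powers. -/
lemma convPow_toReal (μ : PMF G) (hfin : μ.support.Finite) (hsymm : IsSymmetric μ) (n : ℕ)
    (x : G) :
    (convPow μ n x).toReal = walkLaw hfin.toFinset (fun y => (μ y).toReal) n x := by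
  classical
  induction n generalizing x with
  | zero =>
    simp only [convPow, walkLaw, Function.iterate_zero, id, PMF.pure_apply]
    by_cases h : x = 1 <;> simp [h]
  | succ n ih =>
    have hmap : ∀ a, (μ.map fun y => a * y) x = μ (a⁻¹ * x) := by
      intro a
      rw [PMF.map_apply, tsum_eq_single (a⁻¹ * x)]
      · simp
      · intro b hb
        rw [if_neg]
        rintro rfl
        simp at hb
    rw [walkLaw_succ, average, convPow, PMF.bind_apply]
    simp only [hmap]
    -- Writing the position before the last step as `x * y` leaves the weight of `y⁻¹`. `walkLaw` is
    -- a priori the law of the inverse of the walk; symmetry of `μ` identifies the two.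
    rw [← (Equiv.mulLeft x).tsum_eq]
    have e : ∀ y, convPow μ n (Equiv.mulLeft x y) * μ ((Equiv.mulLeft x y)⁻¹ * x)
        = convPow μ n (x * y) * μ y := by
      intro y
      rw [Equiv.coe_mulLeft, ← hsymm y]; congr 2; group
    simp only [e]
    rw [tsum_eq_sum (s := hfin.toFinset), ENNReal.toReal_sum]
    · refine Finset.sum_congr rfl fun y _ => ?_
      rw [ENNReal.toReal_mul, ih, mul_comm]
    · exact fun y _ => ENNReal.mul_ne_top (PMF.apply_ne_top _ _) (PMF.apply_ne_top _ _)
    · intro y hy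
      have : μ y = 0 := by simpa using hy
      simp [this]

end Walk

/-! ### The isoperimetric profile in terms of sets and test functions -/

section Profile

variable {G : Type*} [Group G]

lemma isoProfile_energy (μ : PMF G) (hfin : μ.support.Finite) (f : G →₀ ℝ) :
    1 / 2 * ∑' p : G × G, |f p.1 - f (p.1 * p.2)| * (μ p.2).toReal
      = energyOne hfin.toFinset id (fun y => (μ y).toReal) f := by
  have hf : (Function.support f).Finite := f.hasFiniteSupport
  have hsupp : ∀ y ∉ hfin.toFinset, μ y = 0 := fun y hy => by simpa using hy
  unfold energyOne
  congr 1
  rw [← (Equiv.prodComm G G).tsum_eq]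
  have hs : Summable fun p : G × G =>
      |f ((Equiv.prodComm G G) p).1 - f (((Equiv.prodComm G G) p).1 * ((Equiv.prodComm G G) p).2)|
        * (μ ((Equiv.prodComm G G) p).2).toReal := by
    refine summable_of_hasFiniteSupport ((hfin.toFinset.finite_toSet.biUnion fun y _ =>
      ((hf.union (finite_support_shift hf y)).image fun x => (y, x))).subset fun p hp => ?_)
    obtain ⟨y, x⟩ := p
    have hp' : |f x - f (x * y)| * (μ y).toReal ≠ 0 := hp
    have hy : y ∈ hfin.toFinset := by
      by_contra h
      simp [hsupp y h] at hp'
    refine Set.mem_biUnion hy ⟨x, ?_, rfl⟩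
    by_contra h
    simp only [Set.mem_union, Function.mem_support, not_or, not_not] at h
    simp [h.1, h.2] at hp'
  rw [hs.tsum_prod]
  simp only [Equiv.prodComm_apply, Prod.fst_swap, Prod.snd_swap]
  rw [tsum_eq_sum (s := hfin.toFinset) (fun y hy => by simp [hsupp y hy])]
  refine Finset.sum_congr rfl fun y _ => ?_
  rw [variation, ← tsum_mul_left]
  exact tsum_congr fun x => mul_comm _ _

lemma energyOne_nonneg {ι : Type*} {S : Finset ι} {s : ι → G} {w : ι → ℝ} (hw : ∀ i, 0 ≤ w i)
    (f : G → ℝ) : 0 ≤ energyOne S s w f :=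
  mul_nonneg (by norm_num) (Finset.sum_nonneg fun i _ => mul_nonneg (hw i) (variation_nonneg _ _))

lemma SetIso.le_isoProfile (μ : PMF G) (hfin : μ.support.Finite) {c v : ℝ}
    (h : SetIso hfin.toFinset id (fun y => (μ y).toReal) c v) (hv : 1 ≤ v) :
    c ≤ isoProfile μ v := by
  refine le_csInf ?_ ?_
  · refine ⟨_, Finsupp.single 1 1, ?_, ?_, rfl⟩
    · rw [Finsupp.support_single _ one_ne_zero]; simpa using hv
    · rw [Finsupp.support_single _ one_ne_zero]; simp
  · rintro E ⟨f, hcard, hone, rfl⟩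
    rw [isoProfile_energy μ hfin]
    have hf : (Function.support f).Finite := f.hasFiniteSupport
    have e : hf.toFinset = f.support := by ext x; simp
    have := h.energyOne_ge_abs (fun _ => ENNReal.toReal_nonneg) hf (by rw [e]; exact hcard)
    rw [tsum_eq_sum (s := f.support) (fun x hx => by simpa using hx), hone, mul_one] at this
    exact this

lemma isoProfile_le (μ : PMF G) (hfin : μ.support.Finite) {f : G → ℝ} (hf : f.support.Finite)
    (h0 : 0 ≤ f) {c v : ℝ} (hv : (hf.toFinset.card : ℝ) ≤ v) (hpos : 0 < ∑' x, f x)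
    (hE : energyOne hfin.toFinset id (fun y => (μ y).toReal) f ≤ c * ∑' x, f x) :
    isoProfile μ v ≤ c := by
  set M := ∑' x, f x with hM
  have hMsum : M = ∑ x ∈ hf.toFinset, f x := tsum_eq_sum fun x hx => by simpa using hx
  set F : G →₀ ℝ := Finsupp.onFinset hf.toFinset (fun x => M⁻¹ * f x)
    (fun x hx => by simpa using right_ne_zero_of_mul hx) with hF
  have hsupp : F.support ⊆ hf.toFinset := Finsupp.support_onFinset_subset
  have hbdd : BddBelow {E : ℝ | ∃ f : G →₀ ℝ, (f.support.card : ℝ) ≤ v ∧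
      ∑ x ∈ f.support, |f x| = 1 ∧
      E = 1 / 2 * ∑' p : G × G, |f p.1 - f (p.1 * p.2)| * (μ p.2).toReal} := by
    refine ⟨0, ?_⟩
    rintro E ⟨f, -, -, rfl⟩
    rw [isoProfile_energy μ hfin]
    exact energyOne_nonneg (fun _ => ENNReal.toReal_nonneg) _
  refine (csInf_le hbdd ⟨F, ?_, ?_, rfl⟩).trans ?_
  · exact (Nat.cast_le.2 (Finset.card_le_card hsupp)).trans hv
  · rw [Finset.sum_subset hsupp fun x _ hx => by simpa using hx]
    have : ∀ x, |F x| = M⁻¹ * f x := fun x => by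
      simp only [hF, Finsupp.onFinset_apply]
      exact abs_of_nonneg (mul_nonneg (inv_nonneg.2 hpos.le) (h0 x))
    simp only [this]
    rw [← Finset.mul_sum, ← hMsum, inv_mul_cancel₀ hpos.ne']
  · rw [isoProfile_energy μ hfin]
    have : energyOne hfin.toFinset id (fun y => (μ y).toReal) F
        = M⁻¹ * energyOne hfin.toFinset id (fun y => (μ y).toReal) f := by
      have hvar : ∀ g, variation (F : G → ℝ) g = M⁻¹ * variation f g := fun g => by
        rw [variation, variation, ← tsum_mul_left]
        refine tsum_congr fun x => ?_
        simp only [hF, Finsupp.onFinset_apply]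
        rw [← mul_sub, abs_mul, abs_of_pos (inv_pos.2 hpos)]
      simp only [energyOne, hvar, Finset.mul_sum]
      exact Finset.sum_congr rfl fun y _ => by ring
    rw [this, inv_mul_le_iff₀ hpos]
    linarith

end Profile

/-! ### Word length and isoperimetry from independent flips -/

section Words

open scoped Pointwise

variable {G : Type*} [Group G] {S : Finset G} {w : G → ℝ}

/-- The isoperimetry of the one-step walk follows from the one of the two-step walk. -/
lemma SetIso.one_step {c v : ℝ}
    (h : SetIso (S ×ˢ S) (fun p => p.1 * p.2) (fun p => w p.1 * w p.2) c v)
    (hw : ∀ y, 0 ≤ w y) (hw1 : ∑ y ∈ S, w y = 1) : SetIso S id w (c / 2) v := by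
  intro A hA
  set k : G → ℝ := Set.indicator (A : Set G) 1
  have hk : k.support.Finite := A.finite_toSet.subset Set.support_indicator_subset
  have h1 := h A hA
  have h2 : energyOne (S ×ˢ S) (fun p => p.1 * p.2) (fun p => w p.1 * w p.2) k
      ≤ 2 * energyOne S id w k := by
    have h3 : ∑ p ∈ S ×ˢ S, w p.1 * w p.2 * variation k (p.1 * p.2)
        ≤ ∑ p ∈ S ×ˢ S, (w p.1 * variation k p.1 * w p.2 + w p.1 * (w p.2 * variation k p.2)) := by
      refine Finset.sum_le_sum fun p _ => ?_
      have := mul_le_mul_of_nonneg_left (variation_mul_le hk p.1 p.2)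
        (mul_nonneg (hw p.1) (hw p.2))
      linarith
    have e1 : ∑ p ∈ S ×ˢ S, w p.1 * variation k p.1 * w p.2 = ∑ y ∈ S, w y * variation k y := by
      rw [Finset.sum_product]
      simp only [← Finset.mul_sum, hw1, mul_one]
    have e2 : ∑ p ∈ S ×ˢ S, w p.1 * (w p.2 * variation k p.2) = ∑ y ∈ S, w y * variation k y := by
      rw [Finset.sum_product]
      simp only [← Finset.mul_sum]
      rw [← Finset.sum_mul, hw1, one_mul]
    rw [Finset.sum_add_distrib, e1, e2] at h3
    unfold energyOne
    simp only [id]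
    linarith
  linarith

lemma exists_mem_pow_of_closure_eq_top (hS : Subsemigroup.closure (S : Set G) = ⊤) (g : G) :
    ∃ n : ℕ, g ∈ (S : Set G) ^ n := by
  have hg : g ∈ Subsemigroup.closure (S : Set G) := hS ▸ Subsemigroup.mem_top g
  induction hg using Subsemigroup.closure_induction with
  | mem x hx => exact ⟨1, by simpa using hx⟩
  | mul x y _ _ hx hy =>
    obtain ⟨m, hm⟩ := hx
    obtain ⟨n, hn⟩ := hy
    exact ⟨m + n, by rw [pow_add]; exact Set.mul_mem_mul hm hn⟩

/-- Inversion keeps the exact length of a word, not merely a bound on it, so conjugating a word of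
even length by a word gives one of even length. -/
lemma inv_mem_pow (hS : ∀ y ∈ S, y⁻¹ ∈ S) {g : G} {n : ℕ} (hg : g ∈ (S : Set G) ^ n) :
    g⁻¹ ∈ (S : Set G) ^ n := by
  have e : ((S : Set G))⁻¹ = S := by
    ext x
    simp only [Set.mem_inv, Finset.mem_coe]
    exact ⟨fun h => by simpa using hS _ h, hS x⟩
  rw [← e, inv_pow]
  simpa using hg

/-- A word of length `2n` is a path of `n` moves of the two-step walk, and each move costs at most
`2 / a²` times the energy, where `a` bounds the weights on `S` from below. -/
lemma exists_variation_le_energyOne (hw : ∀ y ∈ S, 0 < w y) (hw0 : ∀ y, 0 ≤ w y) :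
    ∃ M : ℝ, 0 < M ∧ ∀ (f : G → ℝ), f.support.Finite → ∀ (n : ℕ), ∀ g ∈ (S : Set G) ^ (2 * n),
      variation f g
        ≤ n * (M * energyOne (S ×ˢ S) (fun p => p.1 * p.2) (fun p => w p.1 * w p.2) f) := by
  obtain ⟨a, ha, hle⟩ : ∃ a : ℝ, 0 < a ∧ ∀ y ∈ S, a ≤ w y := by
    rcases S.eq_empty_or_nonempty with rfl | hne
    · exact ⟨1, one_pos, by simp⟩
    · obtain ⟨b, hb, hmin⟩ := S.exists_min_image w hne
      exact ⟨w b, hw b hb, hmin⟩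
  refine ⟨2 / a ^ 2, by positivity, fun f hf n => ?_⟩
  set E := energyOne (S ×ˢ S) (fun p => p.1 * p.2) (fun p => w p.1 * w p.2) f with hE
  have hpair : ∀ y ∈ S, ∀ z ∈ S, variation f (y * z) ≤ 2 / a ^ 2 * E := by
    intro y hy z hz
    have h1 : w y * w z * variation f (y * z) ≤ 2 * E := by
      have := Finset.single_le_sum (f := fun p : G × G => w p.1 * w p.2 * variation f (p.1 * p.2))
        (fun p _ => mul_nonneg (mul_nonneg (hw0 p.1) (hw0 p.2)) (variation_nonneg f _))
        (Finset.mk_mem_product hy hz)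
      rw [hE]; unfold energyOne
      simp only at this ⊢
      linarith
    have h2 : a ^ 2 ≤ w y * w z := by
      rw [sq]; exact mul_le_mul (hle y hy) (hle z hz) ha.le (hw0 y)
    have h3 := mul_le_mul_of_nonneg_right h2 (variation_nonneg f (y * z))
    rw [div_mul_eq_mul_div, le_div_iff₀ (by positivity)]
    linarith
  induction n with
  | zero =>
    intro g hg
    have : g = 1 := by simpa using hg
    simp [this, variation]
  | succ n ih =>
    intro g hg
    rw [mul_add, mul_one, pow_add, pow_two] at hg
    obtain ⟨g', hg', _, ⟨y, hy, z, hz, rfl⟩, rfl⟩ := hg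
    have h1 := variation_mul_le hf g' (y * z)
    have h2 := ih g' hg'
    have h3 := hpair y hy z hz
    push_cast
    linarith

/-- A large family of independent sign flips forces isoperimetry at doubly exponential scale. -/
lemma setIso_of_flips {ι J : Type*} {T : Finset J} {s : J → G} {m : J → ℝ} (I : Finset ι)
    (hI : I.Nonempty) (κ : ι → G) (χ : ι → G → ℤˣ)
    (hflip : ∀ i ∈ I, ∀ x, χ i (x * κ i) = -χ i x)
    (hkeep : ∀ i ∈ I, ∀ j ∈ I, i ≠ j → ∀ x, χ i (x * κ j) = χ i x) {M : ℝ} (hM : 0 < M)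
    (hvar : ∀ i ∈ I, ∀ f : G → ℝ, f.support.Finite → variation f (κ i) ≤ M * energyOne T s m f) :
    SetIso T s m (1 / (2 * M)) (Real.exp (I.card * Real.log 2 / 2)) := by
  classical
  intro A hA
  set k : G → ℝ := Set.indicator (A : Set G) 1 with hk
  have hkf : k.support.Finite := A.finite_toSet.subset Set.support_indicator_subset
  have hcomb := card_inner_edges_le (fun i x => x * κ i) χ (fun i => mul_left_injective (κ i)) I
    hflip hkeep A
  have hlog : (A.card : ℝ) * Real.log A.card ≤ A.card * (I.card * Real.log 2 / 2) := by
    rcases A.card.eq_zero_or_pos with h | h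
    · simp [h]
    · refine mul_le_mul_of_nonneg_left ?_ (by positivity)
      rw [Real.log_le_iff_le_exp (by positivity)]
      exact hA
  have hl2 : 0 < Real.log 2 := Real.log_pos (by norm_num)
  -- Since `log |A| ≤ |I| log 2 / 2`, at most half of the `|A| |I|` edges issuing from `A` end in
  -- `A`.
  have hin : ∑ i ∈ I, ((A.filter fun x => x * κ i ∈ A).card : ℝ) ≤ A.card * I.card / 2 := by
    refine le_of_mul_le_mul_right ?_ hl2
    linarith
  -- Keeping only the terms with `x ∈ A`, the variation of the indicator counts the points that
  -- direction `i` moves out of `A`.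
  have hv : ∀ i ∈ I, (A.card : ℝ) - (A.filter fun x => x * κ i ∈ A).card
      ≤ M * energyOne T s m k := by
    intro i hi
    refine le_trans ?_ (hvar i hi k hkf)
    refine le_trans (le_of_eq ?_)
      ((summable_variation hkf (κ i)).sum_le_tsum A fun x _ => abs_nonneg _)
    rw [Finset.card_filter, Finset.card_eq_sum_ones]
    push_cast
    rw [← Finset.sum_sub_distrib]
    refine Finset.sum_congr rfl fun x hx => ?_
    by_cases h : x * κ i ∈ A <;> simp [hk, hx, h]
  have hsum := Finset.sum_le_sum hv
  rw [Finset.sum_sub_distrib, Finset.sum_const, Finset.sum_const, nsmul_eq_mul, nsmul_eq_mul]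
    at hsum
  have hIpos : (0 : ℝ) < I.card := Nat.cast_pos.2 hI.card_pos
  have h2 : (I.card : ℝ) * (A.card / 2) ≤ I.card * (M * energyOne T s m k) := by linarith
  have h3 := le_of_mul_le_mul_left h2 hIpos
  rw [div_mul_eq_mul_div, div_le_iff₀ (by positivity)]
  linarith

end Words

/-! ### Level shift, label shift, rotations and sign flips -/

section Elements

variable {q : ℕ} [NeZero q]

/-- The zero sequence of level `l`. -/
def zeroVertex (q : ℕ) [NeZero q] (l : ℤ) : Vertex q where
  level := l
  label := fun _ => 0
  label_above := fun _ _ => rfl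
  label_below := ⟨0, fun _ _ => rfl⟩

@[simp] lemma zeroVertex_level (l : ℤ) : (zeroVertex q l).level = l := rfl

@[simp] lemma zeroVertex_label (l k : ℤ) : (zeroVertex q l).label k = 0 := rfl

lemma zeroVertex_parent (l : ℤ) : (zeroVertex q l).parent = zeroVertex q (l - 1) := by
  ext k
  · rfl
  · simp [Vertex.parent, zeroVertex]

lemma zeroVertex_child (l : ℤ) : (zeroVertex q l).child 0 = zeroVertex q (l + 1) := by
  ext k
  · rfl
  · simp [Vertex.child, zeroVertex]

lemma ray_eq (n : ℕ) : ray q n = zeroVertex q (-n) := rfl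

lemma zeroVertex_parent_iterate (l : ℤ) (n : ℕ) :
    Vertex.parent^[n] (zeroVertex q l) = zeroVertex q (l - n) := by
  induction n with
  | zero => simp
  | succ n ih =>
    rw [Function.iterate_succ_apply', ih, zeroVertex_parent]; push_cast; congr 1; ring

lemma exists_parent_iterate_eq (v : Vertex q) :
    ∃ N : ℕ, ∀ n, N ≤ n → Vertex.parent^[n] v = zeroVertex q (v.level - n) := by
  obtain ⟨N, hN⟩ := exists_ancestors_ray v
  refine ⟨N, fun n hn => ?_⟩
  obtain ⟨k, hk, h⟩ := hN n hn
  rw [h, ray_eq, hk]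
  congr 1; ring

lemma act_parent_iterate (g : affineGroup q) (v : Vertex q) (n : ℕ) :
    g.1 (Vertex.parent^[n] v) = Vertex.parent^[n] (g.1 v) := by
  induction n with
  | zero => rfl
  | succ n ih => rw [Function.iterate_succ_apply', Function.iterate_succ_apply',
      affine_parent g.2, ih]

/-- The change of level under an affine transformation. -/
def levelShift (g : affineGroup q) : ℤ := (g.1 (zeroVertex q 0)).level

/-- The change of level is the same at a vertex and at its ancestors, and every vertex shares a
distant ancestor with `ω(0)` on the ray. -/
lemma act_level (g : affineGroup q) (v : Vertex q) : (g.1 v).level = v.level + levelShift g := by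
  have hp : ∀ (v : Vertex q) (n : ℕ),
      (g.1 (Vertex.parent^[n] v)).level - (Vertex.parent^[n] v).level
        = (g.1 v).level - v.level := by
    intro v n
    rw [act_parent_iterate, parent_iterate_level, parent_iterate_level]; ring
  obtain ⟨N, hN⟩ := exists_parent_iterate_eq v
  have h1 := hp v (N + v.level.toNat)
  rw [hN _ (by omega)] at h1
  have h2 := hp (zeroVertex q 0) (N + v.level.toNat - v.level).toNat
  rw [zeroVertex_parent_iterate] at h2
  have e : (0 : ℤ) - ((N + v.level.toNat - v.level).toNat : ℤ)
      = v.level - ((N + v.level.toNat : ℕ) : ℤ) := by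
    push_cast; omega
  rw [e, h1] at h2
  simp only [zeroVertex_level, sub_zero] at h2
  unfold levelShift
  omega

@[simp] lemma levelShift_one : levelShift (1 : affineGroup q) = 0 := rfl

lemma levelShift_mul (g h : affineGroup q) : levelShift (g * h) = levelShift g + levelShift h := by
  have h1 : levelShift (g * h) = (g.1 (h.1 (zeroVertex q 0))).level := rfl
  rw [h1, act_level, act_level]
  simp; ring

lemma levelShift_inv (g : affineGroup q) : levelShift g⁻¹ = -levelShift g := by
  have h := levelShift_mul g g⁻¹
  rw [mul_inv_cancel, levelShift_one] at h
  omega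

lemma act_mul (g h : affineGroup q) (v : Vertex q) : (g * h).1 v = g.1 (h.1 v) := rfl

lemma act_inv_act (g : affineGroup q) (v : Vertex q) : g⁻¹.1 (g.1 v) = v :=
  g.1.symm_apply_apply v

lemma act_act_inv (g : affineGroup q) (v : Vertex q) : g.1 (g⁻¹.1 v) = v :=
  g.1.apply_symm_apply v

lemma portrait_inv (g : affineGroup q) (v : Vertex q) :
    portrait g⁻¹ v = (portrait g (g⁻¹.1 v))⁻¹ := by
  have h := portrait_mul g g⁻¹ v
  rw [mul_inv_cancel, portrait_one] at h
  exact eq_inv_of_mul_eq_one_right h.symm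

lemma portrait_apply (g : affineGroup q) (v : Vertex q) (t : Fin q) :
    portrait g v t = (g.1 (v.child t)).last := rfl

/-- Bijections of the vertices commuting with taking ancestors are automorphisms. -/
def isoOfParent (e : Vertex q ≃ Vertex q) (h : ∀ v, e v.parent = (e v).parent) :
    tree q ≃g tree q where
  toEquiv := e
  map_rel_iff' := by
    intro u v
    change (e u = (e v).parent ∨ e v = (e u).parent) ↔ (u = v.parent ∨ v = u.parent)
    rw [← h, ← h, e.injective.eq_iff, e.injective.eq_iff]

/-- The image of `ω(n)` is the `n`-th ancestor of the image of `ω(0)`, hence lies on the ray for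
large `n`. Up to finitely many vertices the map thus shifts the ray along itself. -/
lemma isoOfParent_mem (e : Vertex q ≃ Vertex q) (h : ∀ v, e v.parent = (e v).parent) :
    isoOfParent e h ∈ affineGroup q := by
  have hit : ∀ n v, e (Vertex.parent^[n] v) = Vertex.parent^[n] (e v) := by
    intro n v
    induction n with
    | zero => rfl
    | succ n ih => rw [Function.iterate_succ_apply', Function.iterate_succ_apply', h, ih]
  obtain ⟨N, hN⟩ := exists_ancestors_ray (e (ray q 0))
  have key : ∀ n, N ≤ n → ∃ k : ℕ, (k : ℤ) = n - (e (ray q 0)).level ∧ e (ray q n) = ray q k := by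
    intro n hn
    obtain ⟨k, hk, hr⟩ := hN n hn
    refine ⟨k, hk, ?_⟩
    rw [← hr, ← hit, ray_eq 0, zeroVertex_parent_iterate, ray_eq]
    congr 2; simp
  set M : ℤ := (e (ray q 0)).level
  change (symmDiff (e '' Set.range (ray q)) (Set.range (ray q))).Finite
  refine (((Set.finite_Iio N).image fun n => e (ray q n)).union
    ((Set.finite_Iio (N + M.natAbs)).image (ray q))).subset ?_
  rintro v (⟨⟨_, ⟨n, rfl⟩, rfl⟩, hv⟩ | ⟨⟨n, rfl⟩, hv⟩)
  · refine Or.inl ⟨n, ?_, rfl⟩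
    by_contra hn
    obtain ⟨k, -, hk⟩ := key n (not_lt.1 hn)
    exact hv ⟨k, hk.symm⟩
  · refine Or.inr ⟨n, ?_, rfl⟩
    by_contra hn
    simp only [Set.mem_Iio, not_lt] at hn
    obtain ⟨k, hk, hr⟩ := key (n + M).toNat (by omega)
    refine hv ⟨_, ⟨(n + M).toNat, rfl⟩, ?_⟩
    rw [hr]
    congr 1
    omega

/-- The shift of labels by `m`. -/
def Vertex.translate (m : ℤ) (v : Vertex q) : Vertex q where
  level := v.level + m
  label := fun k => v.label (k - m)
  label_above := fun k hk => v.label_above _ (by omega)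
  label_below := by
    obtain ⟨n, hn⟩ := v.label_below
    exact ⟨n + m, fun k hk => hn _ (by omega)⟩

/-- The shift of labels as an affine transformation. -/
def shiftAffine (q : ℕ) [NeZero q] : affineGroup q :=
  ⟨isoOfParent
    { toFun := Vertex.translate 1
      invFun := Vertex.translate (-1)
      left_inv := fun v => by ext k <;> simp [Vertex.translate]
      right_inv := fun v => by ext k <;> simp [Vertex.translate] }
    (fun v => by
      ext k
      · simp [Vertex.translate]
      · by_cases hk : k = v.level + 1
        · subst hk; simp [Vertex.translate, Vertex.parent]
        · simp [Vertex.translate, Vertex.parent, Function.update_of_ne hk,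
            Function.update_of_ne (show k - 1 ≠ v.level by omega)]),
    isoOfParent_mem _ _⟩

lemma shiftAffine_apply (v : Vertex q) : (shiftAffine q).1 v = v.translate 1 := rfl

lemma portrait_shiftAffine (v : Vertex q) : portrait (shiftAffine q) v = 1 := by
  ext t : 1
  rw [portrait_apply, shiftAffine_apply]
  simp [Vertex.last, Vertex.translate, Vertex.child]

/-- The shift of labels as an element of `DA(𝕋)`. -/
def shift (q : ℕ) [NeZero q] : DA q :=
  ⟨shiftAffine q, by
    change {v | portrait (shiftAffine q) v ≠ 1}.Finite
    simp [portrait_shiftAffine]⟩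

lemma portrait_shift (v : Vertex q) : portrait (shift q).1 v = 1 := portrait_shiftAffine v

lemma levelShift_shift : levelShift (shift q).1 = 1 := rfl

lemma shift_zeroVertex (l : ℤ) : (shift q).1.1 (zeroVertex q l) = zeroVertex q (l + 1) := by
  ext k <;> rfl

/-- Apply the permutation `σ` to the letter of index `1` of the descendants of `ω(0)`. -/
noncomputable def Vertex.rotate (σ : Equiv.Perm (Fin q)) (v : Vertex q) : Vertex q :=
  open Classical in
  if h : 1 ≤ v.level ∧ ∀ k ≤ 0, v.label k = 0 then
    { level := v.level
      label := Function.update v.label 1 (σ (v.label 1))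
      label_above := fun k hk => by
        rw [Function.update_of_ne (by omega)]; exact v.label_above k hk
      label_below := ⟨0, fun k hk => by
        rw [Function.update_of_ne (by omega)]; exact h.2 k hk⟩ }
  else v

lemma Vertex.rotate_level (σ : Equiv.Perm (Fin q)) (v : Vertex q) :
    (v.rotate σ).level = v.level := by
  unfold Vertex.rotate; split_ifs <;> rfl

lemma Vertex.rotate_of_not (σ : Equiv.Perm (Fin q)) {v : Vertex q}
    (h : ¬ (1 ≤ v.level ∧ ∀ k ≤ 0, v.label k = 0)) : v.rotate σ = v := dif_neg h

lemma Vertex.rotate_label_of_ne (σ : Equiv.Perm (Fin q)) (v : Vertex q) {k : ℤ} (hk : k ≠ 1) :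
    (v.rotate σ).label k = v.label k := by
  unfold Vertex.rotate; split_ifs
  · exact Function.update_of_ne hk _ _
  · rfl

lemma Vertex.rotate_label_one (σ : Equiv.Perm (Fin q)) {v : Vertex q}
    (h : 1 ≤ v.level ∧ ∀ k ≤ 0, v.label k = 0) : (v.rotate σ).label 1 = σ (v.label 1) := by
  unfold Vertex.rotate; rw [dif_pos h]; simp only [Function.update_self]

lemma Vertex.rotate_cond (σ : Equiv.Perm (Fin q)) (v : Vertex q) :
    (1 ≤ (v.rotate σ).level ∧ ∀ k ≤ 0, (v.rotate σ).label k = 0)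
      ↔ (1 ≤ v.level ∧ ∀ k ≤ 0, v.label k = 0) := by
  rw [Vertex.rotate_level]
  refine and_congr_right fun _ => forall₂_congr fun k hk => ?_
  rw [Vertex.rotate_label_of_ne _ _ (by omega)]

lemma Vertex.rotate_rotate (σ τ : Equiv.Perm (Fin q)) (h : σ * τ = 1) (v : Vertex q) :
    (v.rotate τ).rotate σ = v := by
  by_cases hv : 1 ≤ v.level ∧ ∀ k ≤ 0, v.label k = 0
  · ext k
    · rw [Vertex.rotate_level, Vertex.rotate_level]
    · by_cases hk : k = 1
      · subst hk
        rw [Vertex.rotate_label_one _ ((Vertex.rotate_cond _ _).2 hv), Vertex.rotate_label_one _ hv,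
          ← Equiv.Perm.mul_apply, h]
        rfl
      · rw [Vertex.rotate_label_of_ne _ _ hk, Vertex.rotate_label_of_ne _ _ hk]
  · rw [Vertex.rotate_of_not τ hv, Vertex.rotate_of_not σ hv]

lemma Vertex.rotate_parent (σ : Equiv.Perm (Fin q)) (v : Vertex q) :
    v.parent.rotate σ = (v.rotate σ).parent := by
  by_cases hv : 1 ≤ v.level ∧ ∀ k ≤ 0, v.label k = 0
  · ext k
    · simp [Vertex.rotate_level]
    · by_cases hk : k = 1
      · subst hk
        by_cases hl : v.level = 1
        · rw [Vertex.rotate_of_not σ (by simp [hl])]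
          simp [Vertex.parent, Vertex.rotate_level, hl]
        · have hp : ∀ k ≠ v.level, v.parent.label k = v.label k := fun k hk =>
            Function.update_of_ne hk _ _
          rw [Vertex.rotate_label_one σ ⟨by rw [Vertex.parent_level]; omega, fun k hk => by
            rw [hp k (by omega)]; exact hv.2 k hk⟩, hp 1 (by omega)]
          simp only [Vertex.parent, Vertex.rotate_level]
          rw [Function.update_of_ne (by omega), Vertex.rotate_label_one σ hv]
      · rw [Vertex.rotate_label_of_ne _ _ hk]
        simp only [Vertex.parent, Vertex.rotate_level]
        by_cases hl : k = v.level
        · simp [hl]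
        · rw [Function.update_of_ne hl, Function.update_of_ne hl,
            Vertex.rotate_label_of_ne _ _ hk]
  · rw [Vertex.rotate_of_not σ hv, Vertex.rotate_of_not σ]
    rintro ⟨h1, h2⟩
    rw [Vertex.parent_level] at h1
    refine hv ⟨by omega, fun k hk => ?_⟩
    rw [← h2 k hk]
    exact (Function.update_of_ne (by omega) _ _).symm

/-- The affine transformation permuting by `σ` the subtrees below `ω(0)`. -/
noncomputable def rotateAffine (σ : Equiv.Perm (Fin q)) : affineGroup q :=
  ⟨isoOfParent
    { toFun := Vertex.rotate σ
      invFun := Vertex.rotate σ⁻¹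
      left_inv := Vertex.rotate_rotate _ _ (by simp)
      right_inv := Vertex.rotate_rotate _ _ (by simp) }
    (Vertex.rotate_parent σ),
    isoOfParent_mem _ _⟩

lemma rotateAffine_apply (σ : Equiv.Perm (Fin q)) (v : Vertex q) :
    (rotateAffine σ).1 v = v.rotate σ := rfl

lemma portrait_rotateAffine_zero (σ : Equiv.Perm (Fin q)) :
    portrait (rotateAffine σ) (zeroVertex q 0) = σ := by
  ext t : 1
  have hl : ((zeroVertex q 0).child t).level = 1 := rfl
  have hc : 1 ≤ ((zeroVertex q 0).child t).level ∧
      ∀ k ≤ 0, ((zeroVertex q 0).child t).label k = 0 := by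
    refine ⟨by rw [hl], fun k hk => ?_⟩
    simp only [Vertex.child, zeroVertex_level]
    rw [Function.update_of_ne (by omega)]; rfl
  rw [portrait_apply, rotateAffine_apply, Vertex.last, Vertex.rotate_level, hl,
    Vertex.rotate_label_one σ hc]
  congr 1

lemma portrait_rotateAffine_of_ne (σ : Equiv.Perm (Fin q)) {v : Vertex q}
    (hv : v ≠ zeroVertex q 0) : portrait (rotateAffine σ) v = 1 := by
  ext t : 1
  rw [portrait_apply, rotateAffine_apply, Vertex.last, Vertex.rotate_level]
  refine Eq.trans ?_ (Vertex.last_child v t)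
  by_cases hl : v.level = 0
  · rw [Vertex.rotate_of_not, Vertex.last]
    rintro ⟨-, h⟩
    refine hv ?_
    ext k
    · exact hl
    · congr 1
      by_cases hk : k ≤ 0
      · rw [← show (v.child t).label k = v.label k from
          Function.update_of_ne (by omega) _ _, h k hk]
        rfl
      · rw [v.label_above k (by omega)]; rfl
  · rw [Vertex.rotate_label_of_ne _ _ (by rw [Vertex.child_level]; omega), Vertex.last]

/-- The element of `DA(𝕋)` permuting by `σ` the subtrees below `ω(0)`. -/
noncomputable def rotation (σ : Equiv.Perm (Fin q)) : DA q :=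
  ⟨rotateAffine σ, (Set.finite_singleton (zeroVertex q 0)).subset fun v hv => by
    by_contra h
    exact hv (portrait_rotateAffine_of_ne σ h)⟩

lemma rotation_apply (σ : Equiv.Perm (Fin q)) (v : Vertex q) :
    (rotation σ).1.1 v = v.rotate σ := rfl

lemma rotation_apply_of_level_le (σ : Equiv.Perm (Fin q)) {v : Vertex q} (hv : v.level ≤ 0) :
    (rotation σ).1.1 v = v := by
  rw [rotation_apply, Vertex.rotate_of_not]; omega

/-- An element of even length flipping the sign of the portrait at `ω(0)` and nowhere else on
the horocycle of level `0`, which it fixes pointwise. -/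
noncomputable def flipper (σ : Equiv.Perm (Fin q)) : DA q :=
  rotation σ * (shift q * rotation σ * (shift q)⁻¹)

lemma flipper_apply (σ : Equiv.Perm (Fin q)) {v : Vertex q} (hv : v.level = 0) :
    (flipper σ).1.1 v = v := by
  change (rotation σ).1.1 ((shift q).1.1 ((rotation σ).1.1 ((shift q).1⁻¹.1 v))) = v
  have h : ((shift q).1⁻¹.1 v).level ≤ 0 := by
    rw [act_level, levelShift_inv, levelShift_shift, hv]; norm_num
  rw [rotation_apply_of_level_le _ h, act_act_inv, rotation_apply_of_level_le _ hv.le]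

lemma portrait_flipper (σ : Equiv.Perm (Fin q)) {v : Vertex q} (hv : v.level = 0) :
    portrait (flipper σ).1 v = portrait (rotation σ).1 v := by
  -- The conjugate by the shift has a nontrivial portrait only on level `1` and is invisible here.
  -- It serves to make the length even: the rotation occurs twice, and the shift once together with
  -- its inverse.
  have h : ((shift q).1⁻¹.1 v).level = -1 := by
    rw [act_level, levelShift_inv, levelShift_shift, hv]; norm_num
  change portrait ((rotation σ).1 * ((shift q).1 * (rotation σ).1 * (shift q).1⁻¹)) v = _
  rw [portrait_mul, portrait_mul, portrait_mul, portrait_inv, portrait_shift, portrait_shift,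
    act_mul, act_mul, rotation_apply_of_level_le _ (by rw [h]; norm_num), act_act_inv]
  have : portrait (rotation σ).1 ((shift q).1⁻¹.1 v) = 1 :=
    portrait_rotateAffine_of_ne σ (by rintro h'; rw [h'] at h; simp at h)
  rw [this]
  simp

/-- In the cocycle formula the portraits of `g` and `g⁻¹` are inverse permutations taken at matching
vertices; their signs cancel because signs commute. -/
lemma sign_portrait_conj (g κ : affineGroup q) {v : Vertex q} (h : κ.1 (g⁻¹.1 v) = g⁻¹.1 v) :
    Equiv.Perm.sign (portrait (g * κ * g⁻¹) v)
      = Equiv.Perm.sign (portrait κ (g⁻¹.1 v)) := by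
  rw [portrait_mul, portrait_mul, h, portrait_inv]
  simp only [map_mul, map_inv]
  rw [mul_right_comm, mul_inv_cancel, one_mul]

end Elements

/-! ### Large boundary: hypercube directions at level `k` -/

section LowerIsoperimetry

open scoped Pointwise

variable {q : ℕ} [NeZero q]

lemma rotation_shift_apply (t : Fin q) :
    (rotation (Equiv.swap 0 t) * shift q).1.1 (zeroVertex q 0) = (zeroVertex q 0).child t := by
  change (rotation (Equiv.swap 0 t)).1.1 ((shift q).1.1 (zeroVertex q 0)) = _
  rw [shift_zeroVertex, ← zeroVertex_child, apply_child,
    rotation_apply_of_level_le _ (by simp)]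
  congr 1
  change portrait (rotateAffine (Equiv.swap 0 t)) (zeroVertex q 0) 0 = t
  rw [portrait_rotateAffine_zero]
  exact Equiv.swap_apply_left 0 t

/-- The vertices below `ω(0)` are reached by words whose length is linear in the level. -/
lemma exists_reaching_family (S : Finset (DA q))
    (hS : ∀ g : DA q, ∃ n : ℕ, g ∈ (S : Set (DA q)) ^ n) :
    ∃ L : ℕ, ∀ k : ℕ, ∃ V : Finset (Vertex q), V.card = q ^ k ∧ ∀ v ∈ V, v.level = k ∧
      ∃ g : DA q, g.1.1 (zeroVertex q 0) = v ∧ ∃ n ≤ L * k, g ∈ (S : Set (DA q)) ^ n := by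
  classical
  choose len hlen using hS
  refine ⟨Finset.univ.sup fun t : Fin q => len (rotation (Equiv.swap 0 t) * shift q), fun k => ?_⟩
  induction k with
  | zero =>
    refine ⟨{zeroVertex q 0}, by simp, fun v hv => ?_⟩
    rw [Finset.mem_singleton] at hv
    subst hv
    exact ⟨rfl, 1, rfl, 0, le_rfl, by simp⟩
  | succ k ih =>
    obtain ⟨V, hcard, hV⟩ := ih
    refine ⟨(V ×ˢ Finset.univ).image fun p : Vertex q × Fin q => p.1.child p.2, ?_, ?_⟩
    · rw [Finset.card_image_of_injective, Finset.card_product, hcard, Finset.card_univ,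
        Fintype.card_fin, pow_succ]
      rintro ⟨u, s⟩ ⟨v, t⟩ h
      have h1 := congrArg Vertex.parent h
      have h2 := congrArg Vertex.last h
      simp only [Vertex.parent_child, Vertex.last_child] at h1 h2
      rw [h1, h2]
    · intro v hv
      simp only [Finset.mem_image, Finset.mem_product, Finset.mem_univ, and_true,
        Prod.exists] at hv
      obtain ⟨u, t, hu, rfl⟩ := hv
      obtain ⟨hlev, g, hg, n, hn, hgn⟩ := hV u hu
      refine ⟨by rw [Vertex.child_level, hlev]; push_cast; rfl, ?_⟩
      -- The new move acts before `g`, which sends the child `t'` of `ω(0)` to the child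
      -- `g[ω(0)](t')` of `u`; the letter is corrected accordingly.
      set t' := (portrait g.1 (zeroVertex q 0))⁻¹ t with ht'
      refine ⟨g * (rotation (Equiv.swap 0 t') * shift q), ?_,
        n + len (rotation (Equiv.swap 0 t') * shift q), ?_, ?_⟩
      · change g.1.1 ((rotation (Equiv.swap 0 t') * shift q).1.1 (zeroVertex q 0)) = _
        rw [rotation_shift_apply, apply_child, hg, ht']
        simp
      · have := Finset.le_sup (f := fun t : Fin q => len (rotation (Equiv.swap 0 t) * shift q))
          (Finset.mem_univ t')
        rw [mul_add, mul_one]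
        exact Nat.add_le_add hn this
      · rw [pow_add]
        exact Set.mul_mem_mul hgn (hlen _)

lemma sign_portrait_flipper_zero (hq : 2 ≤ q) :
    Equiv.Perm.sign (portrait (flipper (Equiv.swap (0 : Fin q) 1)).1 (zeroVertex q 0)) = -1 := by
  rw [portrait_flipper _ rfl]
  change Equiv.Perm.sign (portrait (rotateAffine _) _) = -1
  rw [portrait_rotateAffine_zero, Equiv.Perm.sign_swap]
  intro h
  have := congrArg Fin.val h
  rw [Fin.val_zero, Fin.val_one', Nat.mod_eq_of_lt (by omega)] at this
  omega

lemma sign_portrait_flipper_of_ne (σ : Equiv.Perm (Fin q)) {v : Vertex q} (hv : v.level = 0)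
    (hne : v ≠ zeroVertex q 0) : Equiv.Perm.sign (portrait (flipper σ).1 v) = 1 := by
  rw [portrait_flipper _ hv]
  change Equiv.Perm.sign (portrait (rotateAffine _) _) = 1
  rw [portrait_rotateAffine_of_ne _ hne, map_one]

/-- Isoperimetry of the two-step walk: sets of size doubly exponential in `k` have relative
boundary at least of order `1 / k`. -/
lemma exists_setIso_two_step (hq : 2 ≤ q) {S : Finset (DA q)} {w : DA q → ℝ}
    (hSinv : ∀ y ∈ S, y⁻¹ ∈ S) (hS : ∀ g : DA q, ∃ n : ℕ, g ∈ (S : Set (DA q)) ^ n)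
    (hw : ∀ y ∈ S, 0 < w y) (hw0 : ∀ y, 0 ≤ w y) :
    ∃ c : ℝ, 0 < c ∧ ∀ k : ℕ, 1 ≤ k →
      SetIso (S ×ˢ S) (fun p => p.1 * p.2) (fun p => w p.1 * w p.2) (c / k)
        (Real.exp ((q : ℝ) ^ k * Real.log 2 / 2)) := by
  obtain ⟨M, hM, hvar⟩ := exists_variation_le_energyOne hw hw0
  obtain ⟨L, hL⟩ := exists_reaching_family S hS
  set κ : DA q := flipper (Equiv.swap 0 1) with hκ
  obtain ⟨a, ha⟩ := hS (rotation (Equiv.swap 0 1))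
  obtain ⟨b, hb⟩ := hS (shift q)
  have hκlen : κ ∈ (S : Set (DA q)) ^ (2 * (a + b)) := by
    rw [show 2 * (a + b) = a + (b + a + b) by ring, pow_add, pow_add, pow_add]
    exact Set.mul_mem_mul ha (Set.mul_mem_mul (Set.mul_mem_mul hb ha) (inv_mem_pow hSinv hb))
  -- The conjugates have length `2 (len v + a + b)`, at most `2 k (L + a + b + 1)` because `len v ≤
  -- L k` and `k ≥ 1`. The extra `1` keeps the constant positive.
  refine ⟨1 / (2 * ((L + a + b + 1) * M)), by positivity, fun k hk => ?_⟩
  obtain ⟨V, hcard, hV⟩ := hL k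
  choose! hlev g hg len hlen hword using hV
  have hkpos : (0 : ℝ) < k := by exact_mod_cast hk
  have hgl : ∀ v ∈ V, levelShift (g v).1 = k := by
    intro v hv
    have := act_level (g v).1 (zeroVertex q 0)
    rw [hg v hv, hlev v hv] at this
    simpa using this.symm
  -- Pulling a vertex of level `k` back by `g v` lands on level `0`, which `κ` fixes pointwise.
  -- Conjugation thus makes every chosen vertex a fixed point, and the signs simply multiply.
  have hback : ∀ u ∈ V, ∀ v ∈ V, ((g v).1⁻¹.1 u).level = 0 := by
    intro u hu v hv
    rw [act_level, levelShift_inv, hgl v hv, hlev u hu]; ring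
  have hfix : ∀ u ∈ V, ∀ v ∈ V, κ.1.1 ((g v).1⁻¹.1 u) = (g v).1⁻¹.1 u := fun u hu v hv =>
    flipper_apply _ (hback u hu v hv)
  have hmul : ∀ u ∈ V, ∀ v ∈ V, ∀ x : DA q,
      Equiv.Perm.sign (portrait (x * (g v * κ * (g v)⁻¹)).1 u)
        = Equiv.Perm.sign (portrait x.1 u)
          * Equiv.Perm.sign (portrait κ.1 ((g v).1⁻¹.1 u)) := by
    intro u hu v hv x
    change Equiv.Perm.sign (portrait (x.1 * ((g v).1 * κ.1 * (g v).1⁻¹)) u) = _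
    rw [portrait_mul, act_mul, act_mul, hfix u hu v hv, act_act_inv, map_mul,
      sign_portrait_conj _ _ (hfix u hu v hv)]
  have h := setIso_of_flips (T := S ×ˢ S) (s := fun p => p.1 * p.2) (m := fun p => w p.1 * w p.2)
    V (Finset.card_pos.1 (by rw [hcard]; positivity)) (fun v => g v * κ * (g v)⁻¹)
    (fun v x => Equiv.Perm.sign (portrait x.1 v))
    (fun v hv x => by
      rw [hmul v hv v hv]
      have : (g v).1⁻¹.1 v = zeroVertex q 0 := by
        nth_rw 2 [← hg v hv]
        exact act_inv_act _ _
      rw [this, hκ, sign_portrait_flipper_zero hq, mul_neg_one])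
    (fun u hu v hv huv x => by
      rw [hmul u hu v hv, hκ, sign_portrait_flipper_of_ne _ (hback u hu v hv), mul_one]
      intro h
      apply huv
      rw [← hg v hv, ← h, act_act_inv])
    (M := k * ((L + a + b + 1) * M)) (by positivity)
    (fun v hv f hf => by
      have hmem : g v * κ * (g v)⁻¹ ∈ (S : Set (DA q)) ^ (2 * (len v + (a + b))) := by
        rw [show 2 * (len v + (a + b)) = len v + 2 * (a + b) + len v by ring, pow_add, pow_add]
        exact Set.mul_mem_mul (Set.mul_mem_mul (hword v hv) hκlen)
          (inv_mem_pow hSinv (hword v hv))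
      refine (hvar f hf _ _ hmem).trans ?_
      have hE := energyOne_nonneg (S := S ×ˢ S) (s := fun p : DA q × DA q => p.1 * p.2)
        (w := fun p => w p.1 * w p.2) (fun p => mul_nonneg (hw0 _) (hw0 _)) f
      rw [mul_assoc, mul_assoc, ← mul_assoc]
      rw [← mul_assoc (k : ℝ)]
      rw [mul_assoc]
      refine mul_le_mul_of_nonneg_right ?_ (mul_nonneg hM.le hE)
      have h1 : len v + (a + b) ≤ k * (L + a + b + 1) := by
        have := hlen v hv
        nlinarith
      exact_mod_cast h1)
  rw [hcard] at h
  push_cast at h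
  convert h using 1
  field_simp

end LowerIsoperimetry

/-! ### Finite boxes and the elements supported in them -/

section Folner

variable {q : ℕ} [NeZero q]

/-- The descendants of `ω(K)` of level less than `K`. -/
def box (q : ℕ) [NeZero q] (K : ℕ) : Set (Vertex q) :=
  {v | -(K : ℤ) ≤ v.level ∧ v.level < K ∧ ∀ k ≤ -(K : ℤ), v.label k = 0}

/-- The portrait of `z` is supported in the box of size `K`. -/
def SupportedIn (K : ℕ) (z : affineGroup q) : Prop := ∀ v ∉ box q K, portrait z v = 1

lemma box_mono {K K' : ℕ} (h : K ≤ K') : box q K ⊆ box q K' := fun _ hv =>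
  ⟨by have := hv.1; omega, by have := hv.2.1; omega, fun k hk => hv.2.2 k (by omega)⟩

lemma SupportedIn.mono {K K' : ℕ} (h : K ≤ K') {z : affineGroup q} (hz : SupportedIn K z) :
    SupportedIn K' z := fun v hv => hz v fun hv' => hv (box_mono h hv')

lemma exists_mem_box (v : Vertex q) : ∃ K, v ∈ box q K := by
  obtain ⟨n, hn⟩ := v.label_below
  exact ⟨n.natAbs + v.level.natAbs + 1, by omega, by omega, fun k hk => hn k (by omega)⟩

lemma exists_supportedIn (z : DA q) : ∃ K, SupportedIn K z.1 := by
  choose κ hκ using exists_mem_box (q := q)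
  have hz : {v | portrait z.1 v ≠ 1}.Finite := z.2
  refine ⟨hz.toFinset.sup κ, fun v hv => ?_⟩
  by_contra h
  exact hv (box_mono (Finset.le_sup (f := κ) (by simpa using h)) (hκ v))

/-- Far up the distinguished ray an affine transformation acts as a translation. -/
lemma SupportedIn.act_zeroVertex {K : ℕ} {z : affineGroup q} (hz : SupportedIn K z) {l : ℤ}
    (hl : l ≤ -K) : z.1 (zeroVertex q l) = zeroVertex q (l + levelShift z) := by
  obtain ⟨N, hN⟩ := exists_parent_iterate_eq (z.1 (zeroVertex q 0))
  have hfar : ∀ n : ℕ, N ≤ n →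
      z.1 (zeroVertex q (-n)) = zeroVertex q (-n + levelShift z) := by
    intro n hn
    have h := hN n hn
    rw [← act_parent_iterate, zeroVertex_parent_iterate, act_level] at h
    simpa [add_comm, sub_eq_add_neg] using h
  -- Descend the ray from far up to level `l`: above the box the portrait is trivial, so each
  -- appended letter `0` is preserved.
  have hstep : ∀ j : ℕ, l - N - l.natAbs + j ≤ -K →
      z.1 (zeroVertex q (l - N - l.natAbs + j))
        = zeroVertex q (l - N - l.natAbs + j + levelShift z) := by
    intro j
    induction j with
    | zero =>
      intro _
      have := hfar (N + l.natAbs - l).toNat (by omega)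
      rw [show (-(((N + l.natAbs - l).toNat : ℕ) : ℤ)) = l - N - l.natAbs + (0 : ℕ) by omega]
        at this
      exact this
    | succ j ih =>
      intro hj
      push_cast at hj ih ⊢
      rw [← add_assoc, ← zeroVertex_child, apply_child, ih (by omega), hz]
      · rw [Equiv.Perm.one_apply, zeroVertex_child]; congr 1; ring
      · intro hmem
        have := hmem.1
        rw [zeroVertex_level] at this
        omega
  have := hstep (N + l.natAbs) (by push_cast; omega)
  rw [show l - N - l.natAbs + ((N + l.natAbs : ℕ) : ℤ) = l by push_cast; ring] at this
  exact this

lemma label_eq_zero_iff_parent_iterate {K : ℕ} {v : Vertex q} {n : ℕ}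
    (hn : v.level - n = -(K : ℤ)) :
    (∀ k ≤ -(K : ℤ), v.label k = 0) ↔ Vertex.parent^[n] v = zeroVertex q (-K) := by
  constructor
  · intro h
    ext k
    · rw [parent_iterate_level, hn]; rfl
    · congr 1
      by_cases hk : k ≤ -(K : ℤ)
      · rw [parent_iterate_label v n (by rw [hn]; exact hk), h k hk]; rfl
      · rw [(Vertex.parent^[n] v).label_above k (by rw [parent_iterate_level, hn]; omega)]; rfl
  · intro h k hk
    rw [← parent_iterate_label v n (by rw [hn]; exact hk), h]; rfl

/-- Let `m` be the level shift. Since `-K + m ≤ -r`, the ancestor of `z v` at level `-K + m` is a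
zero sequence. It is the image of `ω(K)`, which `z` merely translates, so by injectivity `v`
descends from `ω(K)`. -/
lemma SupportedIn.mem_box_of_act {K r : ℕ} {z : affineGroup q} (hz : SupportedIn K z)
    (hK : |levelShift z| + r ≤ K) {v : Vertex q} (hv : z.1 v ∈ box q r) : v ∈ box q K := by
  obtain ⟨h1, h2, h3⟩ := hv
  rw [act_level] at h1 h2
  have hm := abs_le.1 (show |levelShift z| ≤ K - r by omega)
  refine ⟨by omega, by omega, ?_⟩
  obtain ⟨n, hn⟩ := Int.eq_ofNat_of_zero_le (show 0 ≤ v.level + K by omega)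
  rw [label_eq_zero_iff_parent_iterate (n := n) (by omega)]
  apply z.1.injective
  rw [hz.act_zeroVertex le_rfl, act_parent_iterate]
  have hlev : (Vertex.parent^[n] (z.1 v)).level = -K + levelShift z := by
    rw [parent_iterate_level, act_level]; omega
  ext k
  · exact hlev
  · congr 1
    by_cases hk : k ≤ -K + levelShift z
    · rw [parent_iterate_label _ _ (by rw [act_level]; omega), h3 k (by omega)]; rfl
    · rw [(Vertex.parent^[n] (z.1 v)).label_above k (by omega)]; rfl

/-- The factor `y` alters the portrait of `z` at `v` only if `z v` lies in the small box, and all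
such `v` are in the large box. It is applied to inverses: right multiplication of `x` by a generator
is left multiplication of `x⁻¹`. -/
lemma SupportedIn.mul {K r : ℕ} {y z : affineGroup q} (hy : SupportedIn r y)
    (hz : SupportedIn K z) (hK : |levelShift z| + r ≤ K) : SupportedIn K (y * z) := by
  intro v hv
  rw [portrait_mul, hz v hv, mul_one]
  exact hy _ fun h => hv (hz.mem_box_of_act hK h)

lemma SupportedIn.shift_mul {K : ℕ} {z : affineGroup q} (j : ℤ) :
    SupportedIn K ((shift q).1 ^ j * z) ↔ SupportedIn K z := by
  have h1 : ∀ z : affineGroup q, SupportedIn K ((shift q).1 * z) ↔ SupportedIn K z := by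
    intro z
    refine forall₂_congr fun v _ => ?_
    rw [portrait_mul, portrait_shift, one_mul]
  induction j using Int.induction_on with
  | zero => simp
  | succ j ih => rw [add_comm, zpow_add, zpow_one, mul_assoc]; exact (h1 _).trans ih
  | pred j ih => rw [← h1, ← mul_assoc, ← zpow_one_add, add_sub_cancel]; exact ih

lemma levelShift_shift_zpow (j : ℤ) : levelShift ((shift q).1 ^ j) = j := by
  induction j using Int.induction_on with
  | zero => rfl
  | succ j ih => rw [zpow_add, zpow_one, levelShift_mul, ih, levelShift_shift]
  | pred j ih => rw [zpow_sub, zpow_one, levelShift_mul, levelShift_inv, ih, levelShift_shift]; rfl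

/-- An affine transformation is determined by its level shift and its portrait. -/
lemma SupportedIn.ext {K : ℕ} {y z : affineGroup q} (hy : SupportedIn K y) (hz : SupportedIn K z)
    (hl : levelShift y = levelShift z) (h : ∀ v ∈ box q K, portrait y v = portrait z v) :
    y = z := by
  have hp : ∀ v, portrait y v = portrait z v := fun v => by
    by_cases hv : v ∈ box q K
    · exact h v hv
    · rw [hy v hv, hz v hv]
  -- Equal portraits propagate equality of the images from an ancestor down to its descendants.
  have key : ∀ n : ℕ, ∀ v : Vertex q, y.1 (Vertex.parent^[n] v) = z.1 (Vertex.parent^[n] v) →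
      y.1 v = z.1 v := by
    intro n
    induction n with
    | zero => exact fun v h => h
    | succ n ih =>
      intro v hv
      rw [Function.iterate_succ_apply] at hv
      have := ih _ hv
      rw [← Vertex.child_parent_last v, apply_child, apply_child, this, hp]
  refine Subtype.ext (RelIso.ext fun v => ?_)
  obtain ⟨N, hN⟩ := exists_parent_iterate_eq v
  refine key (N + (v.level + K).toNat) v ?_
  rw [hN _ (by omega), hy.act_zeroVertex (by push_cast; omega),
    hz.act_zeroVertex (by push_cast; omega), hl]

lemma box_injOn (K : ℕ) : Set.InjOn (fun v : Vertex q =>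
    ((v.level, fun k => v.label k) : ℤ × (Finset.Ico (-(K : ℤ)) K → Fin q))) (box q K) := by
  intro u hu v hv h
  simp only [Prod.mk.injEq] at h
  ext k
  · exact h.1
  · congr 1
    by_cases h1 : k ≤ -(K : ℤ)
    · rw [hu.2.2 k h1, hv.2.2 k h1]
    · by_cases h2 : k < K
      · exact congrFun h.2 ⟨k, by rw [Finset.mem_Ico]; omega⟩
      · rw [u.label_above k (by have := hu.2.1; omega), v.label_above k (by have := hv.2.1; omega)]

lemma box_finite_card (K : ℕ) :
    (box q K).Finite ∧ (box q K).ncard ≤ 2 * K * q ^ (2 * K) := by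
  classical
  set T : Finset (ℤ × (Finset.Ico (-(K : ℤ)) K → Fin q)) :=
    Finset.Ico (-(K : ℤ)) K ×ˢ Finset.univ with hT
  have hmaps : Set.MapsTo (fun v : Vertex q =>
      ((v.level, fun k => v.label k) : ℤ × (Finset.Ico (-(K : ℤ)) K → Fin q)))
      (box q K) (T : Set _) := by
    intro v hv
    simp only [hT, Finset.coe_product, Set.mem_prod, Finset.coe_Ico, Set.mem_Ico, Finset.coe_univ,
      Set.mem_univ, and_true]
    exact ⟨hv.1, hv.2.1⟩
  refine ⟨Set.Finite.of_injOn hmaps (box_injOn K) T.finite_toSet, ?_⟩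
  refine (Set.ncard_le_ncard_of_injOn _ hmaps (box_injOn K) T.finite_toSet).trans (le_of_eq ?_)
  have hI : (Finset.Ico (-(K : ℤ)) K).card = 2 * K := by rw [Int.card_Ico]; omega
  rw [Set.ncard_coe_finset, hT, Finset.card_product, Finset.card_univ, Fintype.card_fun,
    Fintype.card_fin, Fintype.card_coe, hI]

/-- The finite group of horocyclic transformations with portrait in the box of size `K`. -/
lemma finite_card_supportedIn (K : ℕ) :
    {z : DA q | SupportedIn K z.1 ∧ levelShift z.1 = 0}.Finite ∧
      {z : DA q | SupportedIn K z.1 ∧ levelShift z.1 = 0}.ncard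
        ≤ q.factorial ^ (2 * K * q ^ (2 * K)) := by
  classical
  obtain ⟨hfin, hcard⟩ := box_finite_card (q := q) K
  have : Fintype (box q K) := hfin.fintype
  have hinj : Set.InjOn (fun (z : DA q) (v : box q K) => portrait z.1 v.1)
      {z : DA q | SupportedIn K z.1 ∧ levelShift z.1 = 0} := by
    intro y hy z hz h
    exact Subtype.ext (hy.1.ext hz.1 (hy.2.trans hz.2.symm) fun v hv => congrFun h ⟨v, hv⟩)
  refine ⟨Set.Finite.of_injOn (Set.mapsTo_univ _ _) hinj Set.finite_univ, ?_⟩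
  refine (Set.ncard_le_ncard_of_injOn _ (fun z _ => Set.mem_univ _) hinj Set.finite_univ).trans ?_
  rw [Set.ncard_univ, Nat.card_eq_fintype_card, Fintype.card_fun, Fintype.card_perm,
    Fintype.card_fin]
  refine Nat.pow_le_pow_right (Nat.factorial_pos q) ?_
  rwa [← Nat.card_eq_fintype_card, Nat.card_coe_set_eq]

/-- The elements with level shift in `J` whose inverse has portrait in the box of size `K` form a
finite set of size proportional to `J`. -/
lemma exists_slab (K : ℕ) : ∃ N : ℕ, 0 < N ∧ N ≤ q.factorial ^ (2 * K * q ^ (2 * K)) ∧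
    ∀ J : Finset ℤ, ∃ X : Finset (DA q), X.card = J.card * N ∧
      ∀ x, x ∈ X ↔ SupportedIn K x.1⁻¹ ∧ levelShift x.1 ∈ J := by
  classical
  obtain ⟨hfin, hcard⟩ := finite_card_supportedIn (q := q) K
  refine ⟨hfin.toFinset.card, ?_, by rwa [← Set.ncard_eq_toFinset_card _ hfin], fun J => ?_⟩
  · refine Finset.card_pos.2 ⟨1, ?_⟩
    rw [Set.Finite.mem_toFinset]
    exact ⟨fun v _ => portrait_one v, rfl⟩
  have hz0 : ∀ z ∈ hfin.toFinset, SupportedIn K z.1 ∧ levelShift z.1 = 0 := fun z hz => by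
    simpa using hz
  have hls : ∀ z ∈ hfin.toFinset, ∀ j : ℤ, levelShift (z⁻¹ * shift q ^ j).1 = j := by
    intro z hz j
    change levelShift (z.1⁻¹ * (shift q).1 ^ j) = j
    rw [levelShift_mul, levelShift_inv, (hz0 z hz).2, levelShift_shift_zpow]; simp
  -- The label shift has trivial portrait, so each level shift contributes one translate of the
  -- inverted horocyclic group, of the same size `N`.
  refine ⟨(hfin.toFinset ×ˢ J).image fun p => p.1⁻¹ * shift q ^ p.2, ?_, fun x => ?_⟩
  · rw [Finset.card_image_of_injOn, Finset.card_product, mul_comm]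
    rintro ⟨y, i⟩ hy ⟨z, j⟩ hz h
    simp only [Finset.coe_product, Set.mem_prod, Finset.mem_coe] at hy hz
    simp only at h
    have hij : i = j := by rw [← hls y hy.1 i, h, hls z hz.1 j]
    subst hij
    simpa using h
  · simp only [Finset.mem_image, Finset.mem_product, Prod.exists]
    constructor
    · rintro ⟨z, j, ⟨hz, hj⟩, rfl⟩
      refine ⟨?_, by rw [hls z hz]; exact hj⟩
      have : (z⁻¹ * shift q ^ j).1⁻¹ = (shift q).1 ^ (-j) * z.1 := by
        change (z.1⁻¹ * (shift q).1 ^ j)⁻¹ = _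
        rw [mul_inv_rev, inv_inv, zpow_neg]
      rw [this, SupportedIn.shift_mul]
      exact (hz0 z hz).1
    · rintro ⟨hx, hj⟩
      refine ⟨shift q ^ levelShift x.1 * x⁻¹, levelShift x.1, ⟨?_, hj⟩, by group⟩
      rw [Set.Finite.mem_toFinset]
      refine ⟨(SupportedIn.shift_mul _).2 hx, ?_⟩
      change levelShift ((shift q).1 ^ levelShift x.1 * x.1⁻¹) = 0
      rw [levelShift_mul, levelShift_shift_zpow, levelShift_inv]; ring

end Folner

/-! ### Small boundary: tent functions on the slabs -/

section FolnerFunction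

/-- With `q! ≤ exp (q²)`, all polynomial factors are absorbed into powers of `q`, leading to the
exponent `4K + 3 = 8k + 12r + 3`, at most `(12r + 11) k` since `k ≥ 1`. -/
lemma slab_size_le {q : ℕ} (hq : 2 ≤ q) {k r K N : ℕ} (hk : 1 ≤ k) (hK : K = 2 * k + 3 * r)
    (hN : N ≤ q.factorial ^ (2 * K * q ^ (2 * K))) :
    ((4 * k + 1 : ℕ) * N : ℝ) ≤ Real.exp (((q : ℝ) ^ (12 * r + 11)) ^ k) := by
  have hexp : 4 * k + q * q * (2 * K * q ^ (2 * K)) ≤ (q ^ (12 * r + 11)) ^ k := by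
    have h1 : 2 * K ≤ q ^ (2 * K) := (Nat.lt_pow_self (by omega)).le
    have h2 : 4 * k ≤ 2 * K := by omega
    have h3 : q * q * (2 * K * q ^ (2 * K)) ≤ q ^ (4 * K + 2) := by
      calc q * q * (2 * K * q ^ (2 * K)) ≤ q * q * (q ^ (2 * K) * q ^ (2 * K)) := by gcongr
        _ = q ^ (4 * K + 2) := by ring
    have h4 : q ^ (2 * K) ≤ q ^ (4 * K + 2) := Nat.pow_le_pow_right (by omega) (by omega)
    have h5 : 2 * q ^ (4 * K + 2) ≤ q ^ (4 * K + 3) := by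
      rw [pow_succ q (4 * K + 2), mul_comm]; gcongr
    have h6 : q ^ (4 * K + 3) ≤ (q ^ (12 * r + 11)) ^ k := by
      rw [← pow_mul]
      refine Nat.pow_le_pow_right (by omega) ?_
      rw [hK]
      nlinarith [Nat.mul_le_mul_left (12 * r + 3) hk]
    omega
  have hfac : (q.factorial : ℝ) ≤ Real.exp ((q * q : ℕ) : ℝ) := by
    have h1 : (q.factorial : ℝ) ≤ (q : ℝ) ^ q := by exact_mod_cast Nat.factorial_le_pow q
    have h2 : (q : ℝ) ≤ Real.exp q := by linarith [Real.add_one_le_exp (q : ℝ)]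
    refine h1.trans ((pow_le_pow_left₀ (by positivity) h2 q).trans (le_of_eq ?_))
    rw [← Real.exp_nat_mul]; push_cast; rfl
  have hNr : (N : ℝ) ≤ Real.exp ((q * q * (2 * K * q ^ (2 * K)) : ℕ) : ℝ) := by
    have h1 : (N : ℝ) ≤ (q.factorial : ℝ) ^ (2 * K * q ^ (2 * K)) := by exact_mod_cast hN
    refine h1.trans ((pow_le_pow_left₀ (by positivity) hfac _).trans (le_of_eq ?_))
    rw [← Real.exp_nat_mul]; push_cast; congr 1; ring
  have hk4 : ((4 * k + 1 : ℕ) : ℝ) ≤ Real.exp ((4 * k : ℕ) : ℝ) := by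
    push_cast; exact Real.add_one_le_exp _
  refine (mul_le_mul hk4 hNr (by positivity) (by positivity)).trans ?_
  rw [← Real.exp_add]
  refine Real.exp_le_exp.2 ?_
  exact_mod_cast hexp

variable {q : ℕ} [NeZero q]

lemma exists_uniform_supportedIn (S : Finset (DA q)) : ∃ r : ℕ, 1 ≤ r ∧ ∀ y ∈ S,
    SupportedIn r y.1 ∧ SupportedIn r y.1⁻¹ ∧ |levelShift y.1| ≤ r := by
  choose κ hκ using exists_supportedIn (q := q)
  set R : DA q → ℕ := fun y => κ y + κ y⁻¹ + (levelShift y.1).natAbs with hR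
  refine ⟨S.sup R + 1, by omega, fun y hy => ?_⟩
  have h : κ y + κ y⁻¹ + (levelShift y.1).natAbs ≤ S.sup R := Finset.le_sup (f := R) hy
  refine ⟨(hκ y).mono (by omega), ?_, ?_⟩
  · exact SupportedIn.mono (z := y.1⁻¹) (by omega) (hκ y⁻¹)
  · rw [Int.abs_eq_natAbs]
    exact_mod_cast (show (levelShift y.1).natAbs ≤ S.sup R + 1 by omega)

/-- The tent function of radius `2k`. -/
noncomputable def tent (k : ℕ) (m : ℤ) : ℝ := max 0 (2 * k - |(m : ℝ)|)

lemma tent_nonneg (k : ℕ) (m : ℤ) : 0 ≤ tent k m := le_max_left _ _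

lemma tent_eq_zero {k : ℕ} {m : ℤ} (h : 2 * k ≤ |m|) : tent k m = 0 := by
  refine max_eq_left ?_
  have : ((2 * k : ℤ) : ℝ) ≤ ((|m| : ℤ) : ℝ) := by exact_mod_cast h
  push_cast at this
  linarith

lemma le_tent {k : ℕ} {m : ℤ} (h : |m| ≤ k) : (k : ℝ) ≤ tent k m := by
  refine le_max_of_le_right ?_
  have : ((|m| : ℤ) : ℝ) ≤ ((k : ℤ) : ℝ) := by exact_mod_cast h
  push_cast at this
  linarith

lemma abs_tent_sub_le (k : ℕ) (m n : ℤ) : |tent k m - tent k n| ≤ |(m : ℝ) - n| := by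
  unfold tent
  rw [max_comm 0, max_comm 0]
  refine (abs_max_sub_max_le_abs _ _ _).trans ?_
  rw [show 2 * (k : ℝ) - |(m : ℝ)| - (2 * k - |(n : ℝ)|) = |(n : ℝ)| - |(m : ℝ)| by ring,
    abs_sub_comm (m : ℝ)]
  exact abs_abs_sub_abs_le _ _

open Classical in
/-- The test function for the upper bound on the isoperimetric profile. -/
noncomputable def folnerFunction (K k : ℕ) (x : DA q) : ℝ :=
  if SupportedIn K x.1⁻¹ then tent k (levelShift x.1) else 0

lemma folnerFunction_nonneg (K k : ℕ) : (0 : DA q → ℝ) ≤ folnerFunction K k := fun x => by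
  unfold folnerFunction; split_ifs
  · exact tent_nonneg _ _
  · exact le_rfl

/-- For level shifts up to `2k + r` the box condition is insensitive to `y`, and only the tent,
which is 1-Lipschitz, varies. Beyond that range both values vanish. -/
lemma abs_folnerFunction_sub_le {K k r : ℕ} (hK : K = 2 * k + 3 * r) {y : DA q}
    (hy : SupportedIn r y.1) (hy' : SupportedIn r y.1⁻¹) (hl : |levelShift y.1| ≤ r) (x : DA q) :
    |folnerFunction K k x - folnerFunction K k (x * y)| ≤ r ∧
      (¬ (SupportedIn K x.1⁻¹ ∧ levelShift x.1 ∈ Finset.Icc (-(2 * k + r : ℤ)) (2 * k + r)) →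
        folnerFunction K k x - folnerFunction K k (x * y) = 0) := by
  have hlev : levelShift (x * y).1 = levelShift x.1 + levelShift y.1 := levelShift_mul _ _
  have hl' := abs_le.1 hl
  by_cases hx : |levelShift x.1| ≤ 2 * k + r
  · have hx' := abs_le.1 hx
    have hiff : SupportedIn K (x * y).1⁻¹ ↔ SupportedIn K x.1⁻¹ := by
      have e : (x * y).1⁻¹ = y.1⁻¹ * x.1⁻¹ := mul_inv_rev x.1 y.1
      rw [e]
      constructor
      · intro h
        -- Undoing `y⁻¹` starts from a level shift up to `2k + 2r`, and `SupportedIn.mul` requires a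
        -- further `r`: this is the margin `3r` in `K`.
        have h2 := hy.mul h (by
          rw [levelShift_mul, levelShift_inv, levelShift_inv]
          have : |(-levelShift y.1 + -levelShift x.1)| ≤ 2 * k + 2 * r := abs_le.2 (by omega)
          omega)
        rwa [mul_inv_cancel_left] at h2
      · intro h
        exact hy'.mul h (by rw [levelShift_inv, abs_neg]; omega)
    by_cases hs : SupportedIn K x.1⁻¹
    · refine ⟨?_, fun h => absurd ⟨hs, Finset.mem_Icc.2 hx'⟩ h⟩
      unfold folnerFunction
      rw [if_pos hs, if_pos (hiff.2 hs), hlev]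
      refine (abs_tent_sub_le _ _ _).trans ?_
      push_cast
      rw [sub_add_cancel_left, abs_neg]
      exact_mod_cast hl
    · have : folnerFunction K k x - folnerFunction K k (x * y) = 0 := by
        unfold folnerFunction
        rw [if_neg hs, if_neg (fun h => hs (hiff.1 h)), sub_zero]
      exact ⟨by rw [this, abs_zero]; positivity, fun _ => this⟩
  · have hx2 : 2 * (k : ℤ) ≤ |levelShift x.1| := by omega
    have hxy : 2 * (k : ℤ) ≤ |levelShift x.1 + levelShift y.1| := by
      have h1 := abs_sub_abs_le_abs_add (levelShift x.1) (levelShift y.1)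
      omega
    have : folnerFunction K k x - folnerFunction K k (x * y) = 0 := by
      unfold folnerFunction
      rw [hlev, tent_eq_zero hx2, tent_eq_zero hxy]
      simp
    exact ⟨by rw [this, abs_zero]; positivity, fun _ => this⟩

/-- Test functions whose support is doubly exponential in `k`, with `L₁` and `L₂` Rayleigh
quotients of order `1 / k` and `1 / k²`. -/
lemma exists_folnerFunction (hq : 2 ≤ q) {S : Finset (DA q)} {w : DA q → ℝ}
    (hw0 : ∀ y, 0 ≤ w y) (hw1 : ∑ y ∈ S, w y = 1) :
    ∃ C : ℝ, 0 < C ∧ ∃ A : ℝ, 1 < A ∧ ∀ k : ℕ, 1 ≤ k → ∃ f : DA q → ℝ,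
      ∃ hf : f.support.Finite, 0 ≤ f ∧ (hf.toFinset.card : ℝ) ≤ Real.exp (A ^ k) ∧
        0 < ∑' x, f x ∧ energyOne S id w f ≤ C / k * ∑' x, f x ∧
        0 < ∑' x, f x ^ 2 ∧ energyTwo S id w f ≤ C / k ^ 2 * ∑' x, f x ^ 2 := by
  obtain ⟨r, hr1, hr⟩ := exists_uniform_supportedIn S
  have hrpos : (0 : ℝ) < r := by exact_mod_cast hr1
  -- The bounds below give quotients at most `7 r² / (4k)` and `7 r³ / (4k²)`; `4 r³` covers both
  -- since `r ≥ 1`.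
  refine ⟨4 * r ^ 3, by positivity, (q : ℝ) ^ (12 * r + 11),
    one_lt_pow₀ (by exact_mod_cast hq) (by omega), fun k hk => ?_⟩
  have hkpos : (0 : ℝ) < k := by exact_mod_cast hk
  set K := 2 * k + 3 * r with hK
  obtain ⟨N, hN0, hN, hslab⟩ := exists_slab (q := q) K
  have hNpos : (0 : ℝ) < N := by exact_mod_cast hN0
  -- `X₀` contains the support of the test function, `X₁` is where it is at least `k`, and `X₂` is
  -- where it can vary. All three have the same factor `N`, which cancels in the quotients.
  obtain ⟨X₀, hX₀, hmem₀⟩ := hslab (Finset.Icc (-(2 * k : ℤ)) (2 * k))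
  obtain ⟨X₁, hX₁, hmem₁⟩ := hslab (Finset.Icc (-(k : ℤ)) k)
  obtain ⟨X₂, hX₂, hmem₂⟩ := hslab (Finset.Icc (-(2 * k + r : ℤ)) (2 * k + r))
  have hc₀ : X₀.card = (4 * k + 1) * N := by rw [hX₀, Int.card_Icc]; congr 1; omega
  have hc₁ : X₁.card = (2 * k + 1) * N := by rw [hX₁, Int.card_Icc]; congr 1; omega
  have hc₂ : X₂.card = (4 * k + 2 * r + 1) * N := by rw [hX₂, Int.card_Icc]; congr 1; omega
  set f : DA q → ℝ := folnerFunction K k with hf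
  have hf0 : 0 ≤ f := folnerFunction_nonneg K k
  have hsub : f.support ⊆ X₀ := by
    intro x hx
    rw [Finset.mem_coe, hmem₀]
    by_contra h
    apply hx
    rw [hf]; unfold folnerFunction
    split_ifs with hs
    · refine tent_eq_zero ?_
      by_contra hlt
      exact h ⟨hs, Finset.mem_Icc.2 (abs_le.1 (not_le.1 hlt).le)⟩
    · rfl
  have hfin : f.support.Finite := X₀.finite_toSet.subset hsub
  have hlow : ∀ x ∈ X₁, (k : ℝ) ≤ f x := by
    intro x hx
    obtain ⟨h1, h2⟩ := (hmem₁ x).1 hx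
    rw [hf]; unfold folnerFunction
    rw [if_pos h1]
    exact le_tent (abs_le.2 (Finset.mem_Icc.1 h2))
  have hL1 : 2 * (k : ℝ) ^ 2 * N ≤ ∑' x, f x := by
    have h1 : (X₁.card : ℝ) * k ≤ ∑' x, f x := by
      rw [← nsmul_eq_mul]
      exact (Finset.card_nsmul_le_sum _ _ _ hlow).trans
        ((summable_map hfin (fun a => a) rfl).sum_le_tsum _ fun x _ => hf0 x)
    rw [hc₁] at h1
    push_cast at h1
    have : 0 ≤ (N : ℝ) * k := by positivity
    nlinarith
  have hL2 : 2 * (k : ℝ) ^ 3 * N ≤ ∑' x, f x ^ 2 := by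
    have h1 : (X₁.card : ℝ) * (k : ℝ) ^ 2 ≤ ∑' x, f x ^ 2 := by
      rw [← nsmul_eq_mul]
      exact (Finset.card_nsmul_le_sum _ _ _ fun x hx =>
        pow_le_pow_left₀ hkpos.le (hlow x hx) 2).trans
        ((summable_map hfin (fun a => a ^ 2) (by simp)).sum_le_tsum _ fun x _ => sq_nonneg _)
    rw [hc₁] at h1
    push_cast at h1
    have : 0 ≤ (N : ℝ) * k ^ 2 := by positivity
    nlinarith
  have hbd : (X₂.card : ℝ) ≤ 7 * r * k * N := by
    rw [hc₂]; push_cast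
    refine mul_le_mul_of_nonneg_right ?_ hNpos.le
    have h1 : (1 : ℝ) ≤ r := by exact_mod_cast hr1
    have h2 : (1 : ℝ) ≤ k := by exact_mod_cast hk
    nlinarith [mul_nonneg (sub_nonneg.2 h1) (sub_nonneg.2 h2)]
  have hdiff := fun y (hy : y ∈ S) =>
    abs_folnerFunction_sub_le hK (hr y hy).1 (hr y hy).2.1 (hr y hy).2.2
  have hzero : ∀ y ∈ S, ∀ x ∉ X₂, f x - f (x * y) = 0 := fun y hy x hx =>
    (hdiff y hy x).2 fun h => hx ((hmem₂ x).2 h)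
  have hvar : ∀ y ∈ S, variation f y ≤ 7 * r * k * N * r := by
    intro y hy
    rw [variation, tsum_eq_sum (s := X₂) fun x hx => by rw [hzero y hy x hx, abs_zero]]
    refine (Finset.sum_le_card_nsmul _ _ (r : ℝ) fun x _ => (hdiff y hy x).1).trans ?_
    rw [nsmul_eq_mul]
    exact mul_le_mul_of_nonneg_right hbd hrpos.le
  have hsq : ∀ y ∈ S, ∑' x, (f x - f (x * y)) ^ 2 ≤ 7 * r * k * N * r ^ 2 := by
    intro y hy
    rw [tsum_eq_sum (s := X₂) fun x hx => by rw [hzero y hy x hx]; simp]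
    refine (Finset.sum_le_card_nsmul _ _ ((r : ℝ) ^ 2) fun x _ => ?_).trans ?_
    · rw [← sq_abs]; exact pow_le_pow_left₀ (abs_nonneg _) (hdiff y hy x).1 2
    · rw [nsmul_eq_mul]
      exact mul_le_mul_of_nonneg_right hbd (by positivity)
  have hmean : ∀ (F : DA q → ℝ) (B : ℝ), (∀ y ∈ S, F y ≤ B) → ∑ y ∈ S, w y * F y ≤ B := by
    intro F B h
    calc ∑ y ∈ S, w y * F y ≤ ∑ y ∈ S, w y * B :=
          Finset.sum_le_sum fun y hy => mul_le_mul_of_nonneg_left (h y hy) (hw0 y)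
      _ = B := by rw [← Finset.sum_mul, hw1, one_mul]
  have hr3 : (r : ℝ) ^ 2 ≤ r ^ 3 := pow_le_pow_right₀ (by exact_mod_cast hr1) (by norm_num)
  refine ⟨f, hfin, hf0, ?_, lt_of_lt_of_le (by positivity) hL1, ?_,
    lt_of_lt_of_le (by positivity) hL2, ?_⟩
  · refine le_trans ?_ (slab_size_le hq hk hK hN)
    have : hfin.toFinset.card ≤ X₀.card := Finset.card_le_card fun x hx =>
      hsub (by simpa using hx)
    rw [hc₀] at this
    exact_mod_cast this
  · calc energyOne S id w f ≤ 1 / 2 * (7 * r * k * N * r) :=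
          mul_le_mul_of_nonneg_left (hmean (fun y => variation f y) _ hvar) (by norm_num)
      _ ≤ 4 * r ^ 3 / k * (2 * k ^ 2 * N) := by
          rw [show 4 * (r : ℝ) ^ 3 / k * (2 * k ^ 2 * N) = 8 * r ^ 3 * (k * N) by
            field_simp; ring]
          have : 0 ≤ (k : ℝ) * N := by positivity
          nlinarith
      _ ≤ 4 * r ^ 3 / k * ∑' x, f x := by gcongr
  · calc energyTwo S id w f ≤ 1 / 2 * (7 * r * k * N * r ^ 2) :=
          mul_le_mul_of_nonneg_left (hmean (fun y => ∑' x, (f x - f (x * y)) ^ 2) _ hsq)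
            (by norm_num)
      _ ≤ 4 * r ^ 3 / k ^ 2 * (2 * k ^ 3 * N) := by
          rw [show 4 * (r : ℝ) ^ 3 / k ^ 2 * (2 * k ^ 3 * N) = 8 * r ^ 3 * (k * N) by
            field_simp; ring]
          have : 0 ≤ (k : ℝ) * N * r ^ 3 := by positivity
          nlinarith
      _ ≤ 4 * r ^ 3 / k ^ 2 * ∑' x, f x ^ 2 := by gcongr

end FolnerFunction

/-! ### Choice of scale and comparison of asymptotics -/

section Asymptotics

lemma SetIso.mono_const {G ι : Type*} [Group G] {S : Finset ι} {s : ι → G} {w : ι → ℝ}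
    {c c' v : ℝ} (h : SetIso S s w c v) (hc : c' ≤ c) : SetIso S s w c' v := fun A hA =>
  (mul_le_mul_of_nonneg_right hc (by positivity)).trans (h A hA)

/-- The scale at which doubly exponential growth exceeds `v`. -/
lemma exists_scale_ge {q : ℕ} (hq : 2 ≤ q) {v : ℝ} (hv : 4 ≤ Real.log v) :
    ∃ k : ℕ, 1 ≤ k ∧ (k : ℝ) ≤ 5 * Real.log (Real.log v) ∧
      v ≤ Real.exp ((q : ℝ) ^ k * Real.log 2 / 2) := by
  set l := Real.log v with hl
  have hl2 : (1 : ℝ) / 2 ≤ Real.log 2 := by linarith [Real.log_two_gt_d9]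
  have hLL : 1 ≤ Real.log l := by
    have h4 : Real.log 4 ≤ Real.log l := Real.log_le_log (by norm_num) hv
    have : Real.log 4 = 2 * Real.log 2 := by
      rw [show (4 : ℝ) = 2 ^ 2 by norm_num, Real.log_pow]; norm_num
    linarith
  -- Since `log 2 ≥ 1/2`, the factor `4` yields `q ^ k ≥ l²`, and `l² log 2 / 2 ≥ l` because `l ≥
  -- 4`.
  have hk := Nat.le_ceil (4 * Real.log l)
  have hk' := (Nat.ceil_lt_add_one (show 0 ≤ 4 * Real.log l by linarith)).le
  set k := ⌈4 * Real.log l⌉₊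
  refine ⟨k, by exact_mod_cast (show (1 : ℝ) ≤ k by linarith), by linarith, ?_⟩
  have h1 : l ^ 2 ≤ (q : ℝ) ^ k := by
    calc l ^ 2 = Real.exp (2 * Real.log l) := by
          rw [mul_comm, ← Real.rpow_def_of_pos (by linarith)]; norm_num
      _ ≤ Real.exp (k * Real.log 2) := Real.exp_le_exp.2 (by nlinarith)
      _ = 2 ^ k := by rw [mul_comm, ← Real.rpow_def_of_pos (by norm_num), Real.rpow_natCast]
      _ ≤ (q : ℝ) ^ k := pow_le_pow_left₀ (by norm_num) (by exact_mod_cast hq) k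
  have hvpos : v ≤ Real.exp l := Real.le_exp_log v
  refine hvpos.trans (Real.exp_le_exp.2 ?_)
  nlinarith

/-- The scale up to which doubly exponential growth stays below `v`. -/
lemma exists_scale_le {A l : ℝ} (hA : 1 < A) (hl : 0 < l) (hLL : Real.log A ≤ Real.log l) :
    ∃ k : ℕ, 1 ≤ k ∧ Real.log l / (2 * Real.log A) ≤ k ∧ A ^ k ≤ l := by
  have hlA := Real.log_pos hA
  set x := Real.log l / Real.log A with hx
  have hx1 : 1 ≤ x := (one_le_div hlA).2 hLL
  have hk := Nat.floor_le (show 0 ≤ x by linarith)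
  have hk1 : 1 ≤ ⌊x⌋₊ := Nat.le_floor (by exact_mod_cast hx1)
  have hk2 := (Nat.lt_floor_add_one x).le
  set k := ⌊x⌋₊
  have hk1' : (1 : ℝ) ≤ k := by exact_mod_cast hk1
  refine ⟨k, hk1, ?_, ?_⟩
  · have : Real.log l / (2 * Real.log A) = x / 2 := by rw [hx]; field_simp
    rw [this]; linarith
  · rw [hx, le_div_iff₀ hlA] at hk
    calc A ^ k = Real.exp (k * Real.log A) := by
          rw [mul_comm, ← Real.rpow_def_of_pos (by linarith), Real.rpow_natCast]
      _ ≤ Real.exp (Real.log l) := Real.exp_le_exp.2 hk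
      _ = l := Real.exp_log hl

lemma exp_neg_two_mul_le_one_sub {x : ℝ} (h0 : 0 ≤ x) (h1 : x ≤ 1 / 2) :
    Real.exp (-(2 * x)) ≤ 1 - x := by
  have h := Real.add_one_le_exp (2 * x)
  rw [Real.exp_neg, inv_le_comm₀ (Real.exp_pos _) (by linarith)]
  refine le_trans ?_ h
  rw [inv_le_iff_one_le_mul₀ (by linarith)]
  nlinarith

lemma sqrt_le_div_log_sq {n : ℝ} (hn : 1 < n) : √n ≤ 16 * (n / Real.log n ^ 2) := by
  have hpos : 0 < n := by linarith
  have hlog := Real.log_pos hn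
  have h1 : Real.log n ≤ 4 * √(√n) := by
    have h2 : Real.log (√(√n)) ≤ √(√n) := by
      have := Real.log_le_sub_one_of_pos (show 0 < √(√n) by positivity)
      linarith
    rw [Real.log_sqrt (by positivity), Real.log_sqrt hpos.le] at h2
    linarith
  have h3 : Real.log n ^ 2 ≤ 16 * √n := by
    calc Real.log n ^ 2 ≤ (4 * √(√n)) ^ 2 := pow_le_pow_left₀ hlog.le h1 2
      _ = 16 * √n := by rw [mul_pow, Real.sq_sqrt (by positivity)]; norm_num
  rw [mul_div_assoc', le_div_iff₀ (by positivity)]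
  have h4 := Real.mul_self_sqrt hpos.le
  nlinarith [Real.sqrt_nonneg n]

/-- A constant inside the argument costs at most a factor `2` in the logarithm; this is what lets
constants in the exponent be traded for the dilation `C₂` of `≲`. -/
lemma half_log_le_log_mul {c t : ℝ} (hc : 0 < c) (ht : 0 < t) (h : 1 / c ^ 2 ≤ t) :
    Real.log t / 2 ≤ Real.log (c * t) := by
  rw [div_le_iff₀ (by positivity)] at h
  have h1 : t ≤ (c * t) ^ 2 := by nlinarith
  have h2 := Real.log_le_log ht h1
  rw [Real.log_pow] at h2
  push_cast at h2
  linarith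

/-- An upper bound `exp (-δ n / (log n)²)` gives the comparison up to the constants of `≲`. -/
lemma asympLE_exp_of_le {p : ℕ → ℝ} {δ : ℝ} (hδ : 0 < δ) {n₀ : ℕ}
    (h : ∀ n, n₀ ≤ n → p n ≤ Real.exp (-(δ * (n / Real.log n ^ 2)))) :
    AsympLE (fun t => p ⌊t⌋₊) fun t => Real.exp (-(t / Real.log t ^ 2)) := by
  -- Of the factor `8`, `4` pays for halving the squared logarithm and `2` for `n ≥ t / 2`.
  refine ⟨1, one_pos, δ / 8, by positivity, ?_⟩
  filter_upwards [eventually_ge_atTop ((n₀ : ℝ) + 4), eventually_ge_atTop (1 / (δ / 8) ^ 2)]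
    with t ht1 ht2
  have hn0 : (0 : ℝ) ≤ n₀ := by positivity
  have ht : 0 < t := by linarith
  set n := ⌊t⌋₊ with hn
  have hfl : (n : ℝ) ≤ t := Nat.floor_le ht.le
  have hfu : t < n + 1 := Nat.lt_floor_add_one t
  have hnn : n₀ ≤ n := Nat.le_floor (by linarith)
  rw [one_mul]
  refine (h n hnn).trans (Real.exp_le_exp.2 (neg_le_neg ?_))
  have hln : 0 < Real.log n := Real.log_pos (by linarith)
  have hlt : 0 < Real.log t := Real.log_pos (by linarith)
  have hlnt : Real.log n ≤ Real.log t := Real.log_le_log (by linarith) hfl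
  have hct := half_log_le_log_mul (show 0 < δ / 8 by positivity) ht ht2
  calc δ / 8 * t / Real.log (δ / 8 * t) ^ 2
      ≤ δ / 8 * t / (Real.log t / 2) ^ 2 := by gcongr
    _ = δ * ((t / 2) / Real.log t ^ 2) := by field_simp; ring
    _ ≤ δ * (n / Real.log n ^ 2) := by gcongr; linarith

/-- A lower bound `exp (-D n / (log n)²)` gives the comparison up to the constants of `≲`. -/
lemma exp_asympLE_of_le {p : ℕ → ℝ} {D : ℝ} (hD : 0 < D) {n₀ : ℕ}
    (h : ∀ n, n₀ ≤ n → Real.exp (-(D * (n / Real.log n ^ 2))) ≤ p n) :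
    AsympLE (fun t => Real.exp (-(t / Real.log t ^ 2))) fun t => p ⌊t⌋₊ := by
  -- The `4` compensates for the halved logarithm, which appears squared.
  set c := 1 / (4 * D) with hc
  have hcpos : 0 < c := by positivity
  refine ⟨1, one_pos, c, hcpos, ?_⟩
  filter_upwards [eventually_ge_atTop (((n₀ : ℝ) + 4) / c), eventually_ge_atTop (1 / (c / 2) ^ 2),
    eventually_ge_atTop 4] with t ht1 ht2 ht3
  rw [div_le_iff₀ hcpos] at ht1
  have hn0 : (0 : ℝ) ≤ n₀ := by positivity
  set n := ⌊c * t⌋₊ with hn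
  have hfl : (n : ℝ) ≤ c * t := Nat.floor_le (by positivity)
  have hfu : c * t < n + 1 := Nat.lt_floor_add_one _
  have hnn : n₀ ≤ n := Nat.le_floor (by linarith)
  rw [one_mul]
  refine le_trans (Real.exp_le_exp.2 (neg_le_neg ?_)) (h n hnn)
  have hlt : 0 < Real.log t := Real.log_pos (by linarith)
  have hlog : Real.log t / 2 ≤ Real.log n :=
    (half_log_le_log_mul (show 0 < c / 2 by positivity) (by linarith) ht2).trans
      (Real.log_le_log (by positivity) (by linarith))
  calc D * (n / Real.log n ^ 2) ≤ D * (c * t / (Real.log t / 2) ^ 2) := by gcongr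
    _ = t / Real.log t ^ 2 := by rw [hc]; field_simp; ring

end Asymptotics

/-! ### The profile and the return probability -/

section Main

lemma sum_toReal_support {G : Type*} (μ : PMF G) (hfin : μ.support.Finite) :
    ∑ y ∈ hfin.toFinset, (μ y).toReal = 1 := by
  have h : ∑' y, μ y = ∑ y ∈ hfin.toFinset, μ y := tsum_eq_sum fun y hy => by simpa using hy
  rw [← ENNReal.toReal_sum fun y _ => PMF.apply_ne_top μ y, ← h, PMF.tsum_coe, ENNReal.toReal_one]

lemma toReal_pos_of_mem_support {G : Type*} (μ : PMF G) (hfin : μ.support.Finite) :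
    ∀ y ∈ hfin.toFinset, 0 < (μ y).toReal := fun y hy =>
  ENNReal.toReal_pos (by simpa using hy) (PMF.apply_ne_top μ y)

lemma IsSymmetric.inv_mem {G : Type*} [Group G] {μ : PMF G} (hsymm : IsSymmetric μ)
    (hfin : μ.support.Finite) : ∀ y ∈ hfin.toFinset, y⁻¹ ∈ hfin.toFinset := fun y hy => by
  simp only [Set.Finite.mem_toFinset, PMF.mem_support_iff, hsymm y] at hy ⊢
  exact hy

variable {q : ℕ} [NeZero q]

lemma exists_setIso (hq : 2 ≤ q) (μ : PMF (DA q)) (hfin : μ.support.Finite)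
    (hsymm : IsSymmetric μ) (hnd : IsNondegenerate μ) :
    ∃ c : ℝ, 0 < c ∧ c ≤ 1 ∧ ∀ k : ℕ, 1 ≤ k →
      SetIso (hfin.toFinset ×ˢ hfin.toFinset) (fun p => p.1 * p.2)
        (fun p => (μ p.1).toReal * (μ p.2).toReal) (c / k)
        (Real.exp ((q : ℝ) ^ k * Real.log 2 / 2)) := by
  obtain ⟨c, hc, h⟩ := exists_setIso_two_step hq (hsymm.inv_mem hfin)
    (exists_mem_pow_of_closure_eq_top (by rw [Set.Finite.coe_toFinset]; exact hnd))
    (toReal_pos_of_mem_support μ hfin) (fun y => ENNReal.toReal_nonneg)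
  -- The cap at `1` ensures `c / k ≤ 1`, as required by `SetIso.walkLaw_le`.
  refine ⟨min c 1, lt_min hc one_pos, min_le_right _ _, fun k hk => (h k hk).mono_const ?_⟩
  gcongr
  exact min_le_left _ _

lemma eventually_le_log (B : ℝ) : ∀ᶠ v : ℝ in atTop, B ≤ Real.log v :=
  Real.tendsto_log_atTop.eventually_ge_atTop B

lemma eventually_le_log_log (B : ℝ) : ∀ᶠ v : ℝ in atTop, B ≤ Real.log (Real.log v) :=
  (Real.tendsto_log_atTop.comp Real.tendsto_log_atTop).eventually_ge_atTop B

/-- The isoperimetric profile of `DA(𝕋)`. -/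
theorem isoProfile_asympEquiv (hq : 2 ≤ q) (μ : PMF (DA q)) (hfin : μ.support.Finite)
    (hsymm : IsSymmetric μ) (hnd : IsNondegenerate μ) :
    AsympEquiv (isoProfile μ) (fun v : ℝ => 1 / Real.log (Real.log v)) := by
  have hw0 : ∀ y, 0 ≤ (μ y).toReal := fun y => ENNReal.toReal_nonneg
  have hw1 := sum_toReal_support μ hfin
  constructor
  · obtain ⟨C, hC, A, hA, h⟩ := exists_folnerFunction hq hw0 hw1
    have hlA := Real.log_pos hA
    refine ⟨2 * C * Real.log A, by positivity, 1, one_pos, ?_⟩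
    filter_upwards [eventually_le_log 1, eventually_le_log_log (Real.log A),
      eventually_gt_atTop 0] with v hv1 hv2 hv0
    obtain ⟨k, hk, hkl, hkA⟩ := exists_scale_le hA (by linarith) hv2
    obtain ⟨f, hf, hf0, hcard, hpos, hE, -⟩ := h k hk
    have hLL : 0 < Real.log (Real.log v) := hlA.trans_le hv2
    have hle : isoProfile μ v ≤ C / k := by
      refine isoProfile_le μ hfin hf hf0 (hcard.trans ?_) hpos hE
      rw [← Real.exp_log hv0]
      exact Real.exp_le_exp.2 hkA
    rw [one_mul]
    refine hle.trans ?_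
    calc C / k ≤ C / (Real.log (Real.log v) / (2 * Real.log A)) := by gcongr
      _ = 2 * C * Real.log A * (1 / Real.log (Real.log v)) := by field_simp
  · obtain ⟨c, hc, -, h⟩ := exists_setIso hq μ hfin hsymm hnd
    refine ⟨10 / c, by positivity, 1, one_pos, ?_⟩
    filter_upwards [eventually_le_log 4, eventually_le_log_log 1, eventually_ge_atTop 1]
      with v hv1 hv2 hv3
    obtain ⟨k, hk, hkl, hkv⟩ := exists_scale_ge hq hv1
    have hkpos : (0 : ℝ) < k := by exact_mod_cast hk
    have hle := SetIso.le_isoProfile μ hfin (((h k hk).mono hkv).one_step hw0 hw1) hv3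
    rw [one_mul]
    calc 1 / Real.log (Real.log v) ≤ 1 / (k / 5) := by gcongr; linarith
      _ = 10 / c * (c / k / 2) := by field_simp; norm_num
      _ ≤ 10 / c * isoProfile μ v := by gcongr

/-- Taking `v = exp (2n)` makes the term `4 / v` negligible, while the scale satisfies `k ≤ 10 log
n`. The other term `(1 - (c / k)² / 4) ^ n` then gives the rate `c² / 400`. -/
lemma exists_walkLaw_le (hq : 2 ≤ q) (μ : PMF (DA q)) (hfin : μ.support.Finite)
    (hsymm : IsSymmetric μ) (hnd : IsNondegenerate μ) :
    ∃ δ : ℝ, 0 < δ ∧ ∀ n : ℕ, 3 ≤ n →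
      walkLaw hfin.toFinset (fun y => (μ y).toReal) (2 * n) 1
        ≤ Real.exp (-(δ * (n / Real.log n ^ 2))) := by
  obtain ⟨c, hc, hc1, h⟩ := exists_setIso hq μ hfin hsymm hnd
  refine ⟨c ^ 2 / 400, by positivity, fun n hn => ?_⟩
  have hn3 : (3 : ℝ) ≤ n := by exact_mod_cast hn
  have hlog : 1 ≤ Real.log n := by
    rw [Real.le_log_iff_exp_le (by linarith)]
    linarith [Real.exp_one_lt_d9]
  obtain ⟨k, hk, hkl, hkv⟩ := exists_scale_ge (v := Real.exp (2 * n)) hq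
    (by rw [Real.log_exp]; linarith)
  rw [Real.log_exp] at hkl
  have hk1 : (1 : ℝ) ≤ k := by exact_mod_cast hk
  have hk10 : (k : ℝ) ≤ 10 * Real.log n := by
    have : Real.log (2 * n) ≤ 2 * Real.log n := by
      rw [Real.log_mul (by norm_num) (by linarith)]
      have := Real.log_le_log (show (0 : ℝ) < 2 by norm_num) (show (2 : ℝ) ≤ n by linarith)
      linarith
    linarith
  have hw := ((h k hk).mono hkv).walkLaw_le (by positivity)
    ((div_le_one (by linarith)).2 (hc1.trans hk1)) (Real.exp_pos _) (hsymm.inv_mem hfin)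
    (fun y => by rw [hsymm y]) (fun y => ENNReal.toReal_nonneg) (sum_toReal_support μ hfin) n
  refine hw.trans (max_le ?_ ?_)
  · have h4 : (4 : ℝ) ≤ Real.exp n := by linarith [Real.add_one_le_exp (n : ℝ)]
    calc 4 / Real.exp (2 * n) ≤ Real.exp n / Real.exp (2 * n) := by gcongr
      _ = Real.exp (-n) := by rw [← Real.exp_sub]; congr 1; ring
      _ ≤ _ := Real.exp_le_exp.2 (neg_le_neg ?_)
    have h1 : (n : ℝ) / Real.log n ^ 2 ≤ n := div_le_self (by linarith) (one_le_pow₀ hlog)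
    have h2 : 0 ≤ (n : ℝ) / Real.log n ^ 2 := by positivity
    have h3 : c ^ 2 / 400 ≤ 1 := by nlinarith
    nlinarith
  · have h1 : 1 - (c / k) ^ 2 / 4 ≤ Real.exp (-((c / k) ^ 2 / 4)) := by
      linarith [Real.add_one_le_exp (-((c / k) ^ 2 / 4))]
    have h0 : 0 ≤ 1 - (c / k) ^ 2 / 4 := by
      have : c / k ≤ 1 := (div_le_one (by linarith)).2 (hc1.trans hk1)
      have h' : 0 ≤ c / k := by positivity
      nlinarith
    refine (pow_le_pow_left₀ h0 h1 n).trans ?_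
    rw [← Real.exp_nat_mul]
    refine Real.exp_le_exp.2 ?_
    rw [mul_neg]
    refine neg_le_neg ?_
    calc c ^ 2 / 400 * (n / Real.log n ^ 2) = n * ((c / (10 * Real.log n)) ^ 2 / 4) := by
          field_simp; norm_num
      _ ≤ n * ((c / k) ^ 2 / 4) := by gcongr

/-- The scale is chosen with `A ^ k ≤ √n`: the support costs at most `exp (√n)`, which is
affordable, while `k` stays of order at least `log n`, so that `n / k²` is `O(n / (log n)²)`. -/
lemma exists_le_walkLaw (hq : 2 ≤ q) (μ : PMF (DA q)) (hfin : μ.support.Finite)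
    (hsymm : IsSymmetric μ) :
    ∃ D : ℝ, 0 < D ∧ ∃ n₀ : ℕ, ∀ n : ℕ, n₀ ≤ n →
      Real.exp (-(D * (n / Real.log n ^ 2)))
        ≤ walkLaw hfin.toFinset (fun y => (μ y).toReal) (2 * n) 1 := by
  have hw1 := sum_toReal_support μ hfin
  obtain ⟨C, hC, A, hA, h⟩ := exists_folnerFunction hq
    (fun y => ENNReal.toReal_nonneg : ∀ y, 0 ≤ (μ y).toReal) hw1
  have hlA := Real.log_pos hA
  -- The first term is `4 C n / k²` with `k ≥ log n / (4 log A)`, the `4` coming from `2n` steps and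
  -- `1 - x ≥ exp (-2x)`. The `16` is the cost of the support from `sqrt_le_div_log_sq`.
  refine ⟨64 * C * Real.log A ^ 2 + 16, by positivity, ?_⟩
  have hev : ∀ᶠ n : ℕ in atTop, 1 < (n : ℝ) ∧ 2 * Real.log A ≤ Real.log n ∧
      4 * Real.log A * (2 * C + 1) ≤ Real.log n :=
    tendsto_natCast_atTop_atTop.eventually ((eventually_gt_atTop (1 : ℝ)).and
      ((eventually_le_log _).and (eventually_le_log _)))
  obtain ⟨n₀, hn₀⟩ := eventually_atTop.1 hev
  refine ⟨n₀, fun n hn => ?_⟩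
  obtain ⟨h1, h2, h3⟩ := hn₀ n hn
  have hnpos : (0 : ℝ) < n := by linarith
  have hlog := Real.log_pos h1
  have hls : Real.log (√n) = Real.log n / 2 := Real.log_sqrt hnpos.le
  obtain ⟨k, hk, hkl, hkA⟩ := exists_scale_le (l := √n) hA (Real.sqrt_pos.2 hnpos)
    (by rw [hls]; linarith)
  rw [hls] at hkl
  have hkl' : Real.log n / (4 * Real.log A) ≤ k := by
    refine le_trans (le_of_eq ?_) hkl
    field_simp; norm_num
  have hk1 : (1 : ℝ) ≤ k := by exact_mod_cast hk
  obtain ⟨f, hf, hf0, hcard, -, -, hpos, hE⟩ := h k hk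
  have hkC : 2 * C + 1 ≤ k := by
    refine le_trans ?_ hkl'
    rw [le_div_iff₀ (by positivity)]; linarith
  have hε : C / k ^ 2 ≤ 1 / 2 := by
    rw [div_le_iff₀ (by positivity)]
    nlinarith
  have hε0 : 0 ≤ C / (k : ℝ) ^ 2 := by positivity
  have hcpos : (0 : ℝ) < hf.toFinset.card := by
    refine Nat.cast_pos.2 (Finset.card_pos.2 ?_)
    by_contra hne
    rw [Finset.not_nonempty_iff_eq_empty, Set.Finite.toFinset_eq_empty,
      Function.support_eq_empty_iff] at hne
    simp [hne] at hpos
  refine le_trans ?_ (le_walkLaw_of_test (hsymm.inv_mem hfin) (fun y => by rw [hsymm y]) hw1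
    hf hf0 hpos (by linarith) hE n)
  calc Real.exp (-((64 * C * Real.log A ^ 2 + 16) * (n / Real.log n ^ 2)))
      ≤ Real.exp (-(2 * (C / k ^ 2)) * (2 * n : ℕ) - A ^ k) := by
        refine Real.exp_le_exp.2 ?_
        have e1 : A ^ k ≤ 16 * (n / Real.log n ^ 2) := hkA.trans (sqrt_le_div_log_sq h1)
        have e2 : C / (k : ℝ) ^ 2 ≤ C / (Real.log n / (4 * Real.log A)) ^ 2 := by gcongr
        have e3 : 4 * (C / (Real.log n / (4 * Real.log A)) ^ 2) * n
            = 64 * C * Real.log A ^ 2 * (n / Real.log n ^ 2) := by field_simp; norm_num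
        have e4 := mul_le_mul_of_nonneg_right e2 hnpos.le
        push_cast
        linarith
    _ = Real.exp (-(2 * (C / k ^ 2))) ^ (2 * n) / Real.exp (A ^ k) := by
        rw [Real.exp_sub, ← Real.exp_nat_mul, mul_comm]
    _ ≤ (1 - C / k ^ 2) ^ (2 * n) / hf.toFinset.card := by
        have hε' : 0 ≤ 1 - C / (k : ℝ) ^ 2 := by linarith
        gcongr
        exact exp_neg_two_mul_le_one_sub hε0 hε

/-- The return probability of the random walks on `DA(𝕋)`. -/
theorem convPow_asympEquiv (hq : 2 ≤ q) (μ : PMF (DA q)) (hfin : μ.support.Finite)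
    (hsymm : IsSymmetric μ) (hnd : IsNondegenerate μ) :
    AsympEquiv (fun t : ℝ => (convPow μ (2 * ⌊t⌋₊) 1).toReal)
      (fun t : ℝ => Real.exp (-(t / (Real.log t) ^ 2))) := by
  simp only [convPow_toReal μ hfin hsymm]
  obtain ⟨δ, hδ, hup⟩ := exists_walkLaw_le hq μ hfin hsymm hnd
  obtain ⟨D, hD, n₀, hlow⟩ := exists_le_walkLaw hq μ hfin hsymm
  exact ⟨asympLE_exp_of_le (p := fun n => walkLaw hfin.toFinset _ (2 * n) 1) hδ hup,
    exp_asympLE_of_le (p := fun n => walkLaw hfin.toFinset _ (2 * n) 1) hD hlow⟩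

end Main

end DiscreteAffine

theorem proposition6p1 (q : ℕ) [NeZero q] (hq : 2 ≤ q)
    (μ : PMF (DiscreteAffine.DA q)) (hfin : μ.support.Finite)
    (hsymm : DiscreteAffine.IsSymmetric μ) (hnd : DiscreteAffine.IsNondegenerate μ) :
    DiscreteAffine.AsympEquiv (DiscreteAffine.isoProfile μ)
        (fun v : ℝ => 1 / Real.log (Real.log v)) ∧
      DiscreteAffine.AsympEquiv
        (fun t : ℝ => (DiscreteAffine.convPow μ (2 * ⌊t⌋₊) 1).toReal)
        (fun t : ℝ => Real.exp (-(t / (Real.log t) ^ 2))) :=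
  ⟨DiscreteAffine.isoProfile_asympEquiv hq μ hfin hsymm hnd,
    DiscreteAffine.convPow_asympEquiv hq μ hfin hsymm hnd⟩
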